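/- Let $D\ge 2$ and let $p(x)=\frac{1}{\sqrt{(2\pi)^D\det\Sigma}}\exp\left(-\tfrac12 x^\top\Sigma^{-1}x\right)$ be the density of the zero-mean normal distribution on $\mathbb R^D$ with positive definite covariance matrix $\Sigma$, and let $\psi=\sqrt p$. A tree tensor network (TTN) shape for $D$ variables is a finite tree together with an assignment of each variable $x_1,\dots,x_D$ to a vertex; the edges of the tree are called inner edges. A functional TTN $\tilde\psi$ of this shape with bond dimensions $\chi_e$ is a function $$\tilde\psi(x)=\sum_{(\alpha_e)_e,\ 1\le\alpha_e\le\chi_e}\ \prod_{v}\gamma_v\big((\alpha_e)_{e\ni v},\,(x_i)_{i\text{ at }v}\big),$$ where each $\gamma_v$ is real-valued and square integrable in the variables at $v$; its bond dimension is $\chi=\max_e\chi_e$. Deleting an inner edge splits the variables into two groups, and $\Sigma$ accordingly into blocks $\Sigma_{11},\Sigma_{12},\Sigma_{21},\Sigma_{22}$; the canonical correlations of this bipartition are the numbers $r\ge 0$ for which $\Sigma_{12}b=r\Sigma_{11}a$, $\Sigma_{21}a=r\Sigma_{22}b$ for some $(a,b)\ne(0,0)$. For every $\rho<1$ there is a constant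 $C>0$, depending only on $\rho$, such that the following holds for all $D\ge2$, all integers $l\ge1$, every TTN shape for $D$ variables and every such $\Sigma$: if for every bipartition induced by an inner edge $\operatorname{rank}\Sigma_{12}\le l$ and all canonical correlations are at most $\rho$, then for every $0<\epsilon\le1$ there is a functional TTN $\tilde\psi$ of the given shape with $$\|\psi-\tilde\psi\|_{L^2(\mathbb R^D)}\le\epsilon\qquad\text{and bond dimension}\qquad \chi\le\left(C\log\frac{l\sqrt D}{\epsilon}\right)^l .$$ -/

import Mathlib

open MeasureTheory

/-- The shape of a tree tensor network for `D` variables: a finite tree whose vertices carry the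
local tensors and whose edges are the inner edges (virtual indices), together with the assignment
of each variable (physical leg) to the vertex it is attached to. A vertex may carry any number of
physical legs. -/
structure TreeShape (D : ℕ) (V : Type*) where
  /-- the inner edges -/
  graph : SimpleGraph V
  /-- the network is connected and has no closed loops -/
  isTree : graph.IsTree
  /-- the vertex to which a physical leg is attached -/
  site : Fin D → V

namespace TreeShape

variable {D : ℕ} {V : Type*}

/-- Inner edges of the network. -/
abbrev Edge (T : TreeShape D V) : Type _ := {e : Sym2 V // e ∈ T.graph.edgeSet}

/-- The inner edges at the vertex `v`. -/
abbrev EdgeAt (T : TreeShape D V) (v : V) : Type _ := {e : T.Edge // v ∈ e.1}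

/-- The variables attached to the vertex `v`. -/
abbrev SiteAt (T : TreeShape D V) (v : V) : Type := {i : Fin D // T.site i = v}

open Classical in
/-- Deleting the inner edge `uv` splits the tree into two components; `T.side u v` is the set of
variables in the component of `u`, and the bipartition induced by the edge is
`T.side u v`, `(T.side u v)ᶜ`. -/
noncomputable def side (T : TreeShape D V) (u v : V) : Finset (Fin D) :=
  Finset.univ.filter fun i => (T.graph.deleteEdges {s(u, v)}).Reachable u (T.site i)

end TreeShape

/-- A functional tree tensor network of shape `T`: each inner edge `e` carries a virtual index
with `bondDim e` values, and each vertex a core depending on the virtual indices of its edges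
and on the variables attached to it, square integrable in the latter. -/
structure FunctionalTTN {D : ℕ} {V : Type*} [DecidableEq V] (T : TreeShape D V) where
  /-- the dimension of the virtual index on each inner edge -/
  bondDim : T.Edge → ℕ
  /-- the local tensors -/
  core : (v : V) → ((e : T.EdgeAt v) → Fin (bondDim e.1)) → (T.SiteAt v → ℝ) → ℝ
  memLp_core : ∀ v α, MemLp (core v α) 2 volume

open Classical in
/-- The function represented by a functional tree tensor network: the product of all cores,
summed over all values of the virtual indices. -/
noncomputable def FunctionalTTN.eval {D : ℕ} {V : Type*} [Fintype V] [DecidableEq V]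
    {T : TreeShape D V} (N : FunctionalTTN T) (x : Fin D → ℝ) : ℝ :=
  ∑ α : (e : T.Edge) → Fin (N.bondDim e),
    ∏ v : V, N.core v (fun e => α e.1) (fun i => x i.1)

/-- The block of `S` with rows in `A` and columns in `B`. -/
def covBlock {D : ℕ} (S : Matrix (Fin D) (Fin D) ℝ) (A B : Finset (Fin D)) : Matrix A B ℝ :=
  S.submatrix Subtype.val Subtype.val

/-- `r` is a canonical correlation of the groups of variables `A` and `Aᶜ` for the covariance
matrix `S`: a nonnegative solution of the generalized eigenvalue problem
`[[0, S₁₂], [S₂₁, 0]] (a, b) = r [[S₁₁, 0], [0, S₂₂]] (a, b)` with `(a, b) ≠ 0`. -/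
def IsCanonicalCorrelation {D : ℕ} (S : Matrix (Fin D) (Fin D) ℝ) (A : Finset (Fin D))
    (r : ℝ) : Prop :=
  0 ≤ r ∧ ∃ (a : A → ℝ) (b : (Aᶜ : Finset (Fin D)) → ℝ), (a ≠ 0 ∨ b ≠ 0) ∧
    (covBlock S A Aᶜ).mulVec b = r • (covBlock S A A).mulVec a ∧
    (covBlock S Aᶜ A).mulVec a = r • (covBlock S Aᶜ Aᶜ).mulVec b

/-- The density of the zero-mean normal distribution on `ℝ^D` with covariance matrix `S`. -/
noncomputable def gaussianDensity {D : ℕ} (S : Matrix (Fin D) (Fin D) ℝ) (x : Fin D → ℝ) : ℝ :=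
  1 / √((2 * Real.pi) ^ D * S.det) * Real.exp (-(1 / 2) * (x ⬝ᵥ S⁻¹.mulVec x))

/-! Let `ψ = √p` be the square root of the Gaussian density.

*One bipartition.* In canonical coordinates of a bipartition `A`, `Aᶜ` with squared canonical
correlations `s k`, the exponent of `ψ` is a function of the first group plus a function of the
second group plus couplings `t k = X k * Z k / (2 * (1 - s k))`, where `X k` are uncorrelated
normalized coordinates of the first group and `Z k` their regressions on the second group
(`exists_canonicalCoordinates`). At most `l` couplings do not vanish. Replacing each `exp (t k)` by
its Taylor polynomial with `N` terms leaves a sum of at most `N ^ l` products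
(`CanonicalCoordinates.sepRank_approximant`). The relative error of one factor is
`exp (-t) * ∑ n < N, t ^ n / n! - 1`; enlarging `t` by `1 / θ` gains `θ ^ N` in the remainder of the
exponential series, and the Gaussian expectation of what is left stays bounded as long as the
canonical correlations are at most `θ ^ 2 < 1` (`lintegral_exp_coupling_le`). Distinct canonical
pairs are independent, so the errors of the factors combine to
`‖∏ Y k - 1‖ + 1 ≤ (1 + δ) ^ l` in the `L²` norm of the Gaussian measure
(`eLpNorm_prod_sub_one_add_one_le`), which is an error `O(l * θ ^ N)`.

*All bipartitions at once.* Root the tree and look at the sides of the edges that avoid the root.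
They form a laminar family, which has at most `D ^ 2` distinct nonempty members. Each bipartite
approximation yields an orthogonal projection, acting on one side only, onto the span of its
factors. Applying these projections from the largest side to the smallest one produces a single
function that has rank at most `N ^ l` across every edge, at the cost of adding the errors
(`exists_sepRank_of_laminar`).

*The network.* A function of rank at most `n` across every edge is exactly a tree tensor network of
bond dimension `n`: starting from a single vertex, split off one vertex at a time and expand the
tensor at its neighbour in the orthonormal family of the side split off (`PartialNetwork.grow`,
`exists_functionalTTN`).

To keep slices and partial integrals of the functions meaningful everywhere instead of almost
everywhere, all functions involved are `Tame`: measurable and dominated pointwise by an integrable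
product weight. With `N` of order `log (l * √D / ε)`, the total error `O(D ^ 2 * l * θ ^ N)` is at
most `ε` (`exists_truncation_order`). -/

namespace GaussianTTN

/-! ### Functions with integrable decay and partial integrals -/

variable {ι : Type*} [Fintype ι] [DecidableEq ι]

/-- The integrable weight `1 / (1 + t²)`; it is at most one, so its powers are integrable too. -/
noncomputable def weight (t : ℝ) : ℝ := (1 + t ^ 2)⁻¹

lemma weight_pos (t : ℝ) : 0 < weight t := by unfold weight; positivity

lemma weight_le_one (t : ℝ) : weight t ≤ 1 := by
  unfold weight
  exact inv_le_one_of_one_le₀ (by nlinarith [sq_nonneg t])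

lemma integrable_weight : Integrable weight volume := integrable_inv_one_add_sq

/-- Functions of `x : ι → ℝ` which depend only on the coordinates in `A` and are dominated by a
multiple of `∏ i ∈ A, 1 / (1 + x i ^ 2)`. Pointwise domination makes every slice of such a function
integrable and square integrable, so partial integrals are defined everywhere, not only almost
everywhere. -/
structure Tame (A : Finset ι) (f : (ι → ℝ) → ℝ) : Prop where
  measurable : Measurable f
  dependsOn : DependsOn f A
  bound : ∃ C : ℝ, 0 ≤ C ∧ ∀ x, |f x| ≤ C * ∏ i ∈ A, weight (x i)

/-- The integral of `f` over the coordinates in `A`, as a function of all coordinates. -/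
noncomputable def partialIntegral (A : Finset ι) (f : (ι → ℝ) → ℝ) (x : ι → ℝ) : ℝ :=
  ∫ y : A → ℝ, f (Function.updateFinset x A y)

namespace Tame

variable {A B : Finset ι} {f g : (ι → ℝ) → ℝ}

omit [Fintype ι] [DecidableEq ι] in
lemma zero (A : Finset ι) : Tame A (fun _ : ι → ℝ => (0 : ℝ)) :=
  ⟨measurable_const, fun _ _ _ => rfl, 0, le_rfl, fun x => by simp⟩

omit [Fintype ι] [DecidableEq ι] in
lemma const (c : ℝ) : Tame ∅ (fun _ : ι → ℝ => c) :=
  ⟨measurable_const, fun _ _ _ => rfl, |c|, abs_nonneg c, fun x => by simp⟩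

omit [Fintype ι] [DecidableEq ι] in
lemma add (hf : Tame A f) (hg : Tame A g) : Tame A (fun x => f x + g x) := by
  obtain ⟨C, hC, hfC⟩ := hf.bound
  obtain ⟨C', hC', hgC⟩ := hg.bound
  refine ⟨hf.measurable.add hg.measurable, fun x y h => ?_, C + C', by positivity, fun x => ?_⟩
  · rw [hf.dependsOn h, hg.dependsOn h]
  · rw [add_mul]; exact (abs_add_le _ _).trans (add_le_add (hfC x) (hgC x))

omit [Fintype ι] [DecidableEq ι] in
lemma const_mul (c : ℝ) (hf : Tame A f) : Tame A (fun x => c * f x) := by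
  obtain ⟨C, hC, hfC⟩ := hf.bound
  refine ⟨hf.measurable.const_mul c, fun x y h => ?_, |c| * C, by positivity, fun x => ?_⟩
  · rw [hf.dependsOn h]
  · rw [abs_mul, mul_assoc]; exact mul_le_mul_of_nonneg_left (hfC x) (abs_nonneg c)

omit [Fintype ι] [DecidableEq ι] in
lemma sub (hf : Tame A f) (hg : Tame A g) : Tame A (fun x => f x - g x) := by
  have := hf.add (hg.const_mul (-1))
  convert this using 2
  ring

omit [Fintype ι] [DecidableEq ι] in
lemma sum {κ : Type*} (s : Finset κ) {f : κ → (ι → ℝ) → ℝ} (hf : ∀ k ∈ s, Tame A (f k)) :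
    Tame A (fun x => ∑ k ∈ s, f k x) := by
  classical
  induction s using Finset.induction_on with
  | empty => simpa using zero A
  | insert a s ha ih =>
    simp only [Finset.sum_insert ha]
    exact (hf a (by simp)).add (ih fun k hk => hf k (by simp [hk]))

omit [Fintype ι] [DecidableEq ι] in
/-- A tame function may be multiplied by a bounded function of the same variables. -/
lemma mul_bounded (hf : Tame A f) (hg : Measurable g) (hgA : DependsOn g A) {K : ℝ}
    (hK : ∀ x, |g x| ≤ K) : Tame A (fun x => f x * g x) := by
  obtain ⟨C, hC, hfC⟩ := hf.bound
  have hK0 : 0 ≤ K := (abs_nonneg _).trans (hK 0)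
  refine ⟨hf.measurable.mul hg, fun x y h => ?_, C * K, by positivity, fun x => ?_⟩
  · rw [hf.dependsOn h, hgA h]
  · rw [abs_mul, mul_right_comm]
    exact mul_le_mul (hfC x) (hK x) (abs_nonneg _) ((abs_nonneg _).trans (hfC x))

omit [Fintype ι] in
lemma mul_union (hf : Tame A f) (hg : Tame B g) : Tame (A ∪ B) (fun x => f x * g x) := by
  obtain ⟨C, hC, hfC⟩ := hf.bound
  obtain ⟨C', hC', hgC⟩ := hg.bound
  refine ⟨hf.measurable.mul hg.measurable, fun x y h => ?_, C * C', by positivity, fun x => ?_⟩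
  · rw [hf.dependsOn fun i hi => h i (by simp_all), hg.dependsOn fun i hi => h i (by simp_all)]
  · rw [abs_mul]
    refine (mul_le_mul (hfC x) (hgC x) (abs_nonneg _) ((abs_nonneg _).trans (hfC x))).trans ?_
    rw [mul_mul_mul_comm]
    refine mul_le_mul_of_nonneg_left ?_ (by positivity)
    rw [← Finset.prod_union_inter]
    exact mul_le_of_le_one_right (Finset.prod_nonneg fun i _ => (weight_pos _).le)
      (Finset.prod_le_one (fun i _ => (weight_pos _).le) fun i _ => weight_le_one _)

omit [Fintype ι] in
lemma mul (hf : Tame A f) (hg : Tame A g) : Tame A (fun x => f x * g x) := by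
  simpa using hf.mul_union hg

omit [Fintype ι] in
lemma sq (hf : Tame A f) : Tame A (fun x => f x ^ 2) := by
  simpa [_root_.sq] using hf.mul hf

omit [Fintype ι] in
/-- Freezing the coordinates outside `B` leaves a function of the coordinates in `B` dominated by
the product weight. -/
lemma bound_slice (hf : Tame A f) (hB : B ⊆ A) :
    ∃ C : ℝ, 0 ≤ C ∧ ∀ x (y : B → ℝ), |f (Function.updateFinset x B y)| ≤
      (C * ∏ i ∈ A \ B, weight (x i)) * ∏ i, weight (y i) := by
  obtain ⟨C, hC, hfC⟩ := hf.bound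
  refine ⟨C, hC, fun x y => (hfC _).trans_eq ?_⟩
  rw [mul_assoc, ← Finset.prod_sdiff hB]
  congr 2
  · refine Finset.prod_congr rfl fun i hi => ?_
    simp [Function.updateFinset, (Finset.mem_sdiff.1 hi).2]
  · rw [← Finset.prod_attach, Finset.univ_eq_attach]
    refine Finset.prod_congr rfl fun i _ => ?_
    simp [Function.updateFinset]

omit [Fintype ι] in
lemma integrable_prod_weight (κ : Type*) [Fintype κ] :
    Integrable (fun y : κ → ℝ => ∏ i, weight (y i)) volume :=
  Integrable.fintype_prod (f := fun _ => weight) fun _ => integrable_weight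

omit [Fintype ι] in
lemma integrable_slice (hf : Tame A f) (hB : B ⊆ A) (x : ι → ℝ) :
    Integrable (fun y : B → ℝ => f (Function.updateFinset x B y)) volume := by
  obtain ⟨C, -, hC⟩ := hf.bound_slice hB
  exact ((integrable_prod_weight B).const_mul _).mono'
    (hf.measurable.comp measurable_updateFinset).aestronglyMeasurable
    (Filter.Eventually.of_forall fun y => by simpa using hC x y)

omit [Fintype ι] in
lemma partialIntegral (hf : Tame A f) (hB : B ⊆ A) : Tame (A \ B) (partialIntegral B f) := by
  obtain ⟨C, hC0, hC⟩ := hf.bound_slice hB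
  refine ⟨?_, ?_, C * ∫ y : B → ℝ, ∏ i, weight (y i), ?_, fun x => ?_⟩
  · have h : StronglyMeasurable (fun p : (ι → ℝ) × (B → ℝ) =>
        f (Function.updateFinset p.1 B p.2)) :=
      (hf.measurable.comp measurable_updateFinset').stronglyMeasurable
    exact h.integral_prod_right.measurable
  · intro x y h
    unfold GaussianTTN.partialIntegral
    congr 1
    ext z
    refine hf.dependsOn fun i hi => ?_
    by_cases hiB : i ∈ B
    · simp [Function.updateFinset, hiB]
    · simp only [Function.updateFinset, hiB, dite_false]
      exact h i (by simp_all)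
  · exact mul_nonneg hC0 (integral_nonneg fun y => Finset.prod_nonneg fun i _ => (weight_pos _).le)
  · have h := norm_integral_le_of_norm_le (f := fun y => f (Function.updateFinset x B y))
      ((integrable_prod_weight B).const_mul (C * ∏ i ∈ A \ B, weight (x i)))
      (Filter.Eventually.of_forall fun y => hC x y)
    rw [integral_const_mul] at h
    rw [mul_right_comm]
    exact h

omit [Fintype ι] in
lemma mul_disjoint_subset {A' : Finset ι} (hf : Tame A f) (hg : Tame B g) (h : A ∪ B = A') :
    Tame A' (fun x => f x * g x) := h ▸ hf.mul_union hg

end Tame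

variable {A B : Finset ι} {f g : (ι → ℝ) → ℝ}

omit [Fintype ι] in
lemma updateFinset_eq_of_dependsOn_compl {β : Type*} {f : (ι → ℝ) → β}
    (hf : ∀ ⦃x y : ι → ℝ⦄, (∀ i ∉ B, x i = y i) → f x = f y)
    (x : ι → ℝ) (y : B → ℝ) : f (Function.updateFinset x B y) = f x :=
  hf fun i hi => by simp [Function.updateFinset, hi]

omit [Fintype ι] in
/-- A factor that does not involve the integrated coordinates can be pulled out. -/
lemma partialIntegral_mul_left (hf : ∀ ⦃x y : ι → ℝ⦄, (∀ i ∉ B, x i = y i) → f x = f y)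
    (g : (ι → ℝ) → ℝ) (x : ι → ℝ) :
    partialIntegral B (fun x => f x * g x) x = f x * partialIntegral B g x := by
  unfold partialIntegral
  simp_rw [updateFinset_eq_of_dependsOn_compl hf]
  exact integral_const_mul _ _

omit [Fintype ι] [DecidableEq ι] in
lemma Tame.congr_off (hf : Tame A f) (h : Disjoint A B) ⦃x y : ι → ℝ⦄
    (hxy : ∀ i ∉ B, x i = y i) : f x = f y :=
  hf.dependsOn fun i hi => hxy i fun hB => Finset.disjoint_left.1 h hi hB

omit [Fintype ι] in
lemma partialIntegral_const_mul (c : ℝ) (f : (ι → ℝ) → ℝ) (x : ι → ℝ) :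
    partialIntegral B (fun x => c * f x) x = c * partialIntegral B f x :=
  integral_const_mul _ _

omit [Fintype ι] in
lemma partialIntegral_sum {κ : Type*} (s : Finset κ) {f : κ → (ι → ℝ) → ℝ}
    (hf : ∀ k ∈ s, Tame A (f k)) (hB : B ⊆ A) (x : ι → ℝ) :
    partialIntegral B (fun x => ∑ k ∈ s, f k x) x = ∑ k ∈ s, partialIntegral B (f k) x :=
  integral_finsetSum _ fun k hk => (hf k hk).integrable_slice hB x

omit [Fintype ι] in
lemma partialIntegral_add (hf : Tame A f) (hg : Tame A g) (hB : B ⊆ A) (x : ι → ℝ) :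
    partialIntegral B (fun x => f x + g x) x = partialIntegral B f x + partialIntegral B g x :=
  integral_add (hf.integrable_slice hB x) (hg.integrable_slice hB x)

omit [Fintype ι] in
lemma partialIntegral_nonneg (hf : ∀ x, 0 ≤ f x) (x : ι → ℝ) : 0 ≤ partialIntegral B f x :=
  integral_nonneg fun _ => hf _

omit [Fintype ι] in
lemma lmarginal_ofReal (hf : Tame A f) (hf0 : ∀ x, 0 ≤ f x) (hB : B ⊆ A) (x : ι → ℝ) :
    lmarginal (fun _ => volume) B (fun x => ENNReal.ofReal (f x)) x =
      ENNReal.ofReal (partialIntegral B f x) := by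
  unfold partialIntegral lmarginal
  rw [ofReal_integral_eq_lintegral_ofReal (hf.integrable_slice hB x)
    (Filter.Eventually.of_forall fun _ => hf0 _)]
  rfl

lemma lintegral_ofReal_le_of_partialIntegral_le (hf : Tame A f) (hg : Tame A g)
    (hf0 : ∀ x, 0 ≤ f x) (hg0 : ∀ x, 0 ≤ g x) (hB : B ⊆ A)
    (h : ∀ x, partialIntegral B f x ≤ partialIntegral B g x) :
    ∫⁻ x, ENNReal.ofReal (f x) ≤ ∫⁻ x, ENNReal.ofReal (g x) := by
  refine lintegral_le_of_lmarginal_le (μ := fun _ => volume) B hf.measurable.ennreal_ofReal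
    hg.measurable.ennreal_ofReal fun x => ?_
  rw [lmarginal_ofReal hf hf0 hB, lmarginal_ofReal hg hg0 hB]
  exact ENNReal.ofReal_le_ofReal (h x)

omit [Fintype ι] [DecidableEq ι] in
lemma eLpNorm_two_eq {Ω : Type*} [MeasurableSpace Ω] {μ : Measure Ω} (f : Ω → ℝ) :
    eLpNorm f 2 μ = (∫⁻ x, ENNReal.ofReal (f x ^ 2) ∂μ) ^ (1 / 2 : ℝ) := by
  rw [eLpNorm_eq_lintegral_rpow_enorm_toReal (by norm_num) (by norm_num)]
  simp only [ENNReal.toReal_ofNat, ENNReal.rpow_ofNat]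
  congr 2
  ext x
  rw [← sq_abs, ENNReal.ofReal_pow (abs_nonneg _), Real.enorm_eq_ofReal_abs]

/-- Square norms can be compared after integrating out only some of the variables. -/
lemma eLpNorm_two_le_of_partialIntegral_le (hf : Tame A f) (hg : Tame A g) (hB : B ⊆ A)
    (h : ∀ x, partialIntegral B (fun x => f x ^ 2) x ≤ partialIntegral B (fun x => g x ^ 2) x) :
    eLpNorm f 2 volume ≤ eLpNorm g 2 volume := by
  rw [eLpNorm_two_eq, eLpNorm_two_eq]
  exact ENNReal.rpow_le_rpow (lintegral_ofReal_le_of_partialIntegral_le hf.sq hg.sq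
    (fun x => sq_nonneg _) (fun x => sq_nonneg _) hB h) (by norm_num)

/-! ### Orthonormal families and projections on a group of variables -/

/-- A family of functions of the variables in `A` that is orthonormal in `L²(ℝ^A)`, except that
some members may vanish almost everywhere. Allowing zeros lets a family of any prescribed length
span a space of smaller dimension. -/
structure OrthoFamily {κ : Type*} (A : Finset ι) (u : κ → (ι → ℝ) → ℝ) : Prop where
  tame : ∀ a, Tame A (u a)
  ortho : ∀ a b, a ≠ b → ∀ x, partialIntegral A (fun x => u a x * u b x) x = 0
  norm_le : ∀ a x, partialIntegral A (fun x => u a x * u a x) x ≤ 1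

/-- The orthogonal projection onto the span of `u` in the variables of `A`, acting on functions of
all variables. -/
noncomputable def proj {κ : Type*} [Fintype κ] (A : Finset ι) (u : κ → (ι → ℝ) → ℝ)
    (f : (ι → ℝ) → ℝ) (x : ι → ℝ) : ℝ :=
  ∑ a, u a x * partialIntegral A (fun x => u a x * f x) x

section proj

variable {κ : Type*} [Fintype κ] {u : κ → (ι → ℝ) → ℝ}

omit [Fintype ι] [Fintype κ] in
lemma OrthoFamily.tame_coeff (hu : OrthoFamily A u) (hf : Tame B f) (hA : A ⊆ B) (a : κ) :
    Tame (B \ A) (partialIntegral A (fun x => u a x * f x)) := by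
  have h := (hu.tame a).mul_union hf
  rw [Finset.union_eq_right.2 hA] at h
  exact h.partialIntegral hA

omit [Fintype ι] in
lemma OrthoFamily.tame_proj (hu : OrthoFamily A u) (hf : Tame B f) (hA : A ⊆ B) :
    Tame B (proj A u f) :=
  Tame.sum _ fun a _ => (hu.tame a).mul_disjoint_subset (hu.tame_coeff hf hA a)
    (Finset.union_sdiff_of_subset hA)

omit [Fintype ι] in
lemma proj_mul_left (hf : ∀ ⦃x y : ι → ℝ⦄, (∀ i ∉ A, x i = y i) → f x = f y)
    (g : (ι → ℝ) → ℝ) (x : ι → ℝ) :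
    proj A u (fun x => f x * g x) x = f x * proj A u g x := by
  unfold proj
  rw [Finset.mul_sum]
  refine Finset.sum_congr rfl fun a _ => ?_
  simp_rw [mul_left_comm (u a _) (f _) (g _)]
  rw [partialIntegral_mul_left hf]
  ring

omit [Fintype ι] in
lemma OrthoFamily.proj_sum {κ' : Type*} (s : Finset κ') {f : κ' → (ι → ℝ) → ℝ}
    (hu : OrthoFamily A u) (hf : ∀ k ∈ s, Tame B (f k)) (hA : A ⊆ B) (x : ι → ℝ) :
    proj A u (fun x => ∑ k ∈ s, f k x) x = ∑ k ∈ s, proj A u (f k) x := by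
  unfold proj
  rw [Finset.sum_comm]
  refine Finset.sum_congr rfl fun a _ => ?_
  simp_rw [Finset.mul_sum]
  rw [partialIntegral_sum s (fun k hk => (hu.tame a).mul_disjoint_subset (hf k hk)
    (Finset.union_eq_right.2 hA)) hA, Finset.mul_sum]

omit [Fintype ι] in
lemma OrthoFamily.proj_sub (hu : OrthoFamily A u) (hf : Tame B f) (hg : Tame B g) (hA : A ⊆ B)
    (x : ι → ℝ) : proj A u (fun x => f x - g x) x = proj A u f x - proj A u g x := by
  have hm : ∀ {h : (ι → ℝ) → ℝ} (a : κ), Tame B h → Tame B (fun x => u a x * h x) :=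
    fun a hh => (hu.tame a).mul_disjoint_subset hh (Finset.union_eq_right.2 hA)
  unfold proj
  rw [← Finset.sum_sub_distrib]
  refine Finset.sum_congr rfl fun a _ => ?_
  rw [← mul_sub]
  congr 1
  simp_rw [mul_sub]
  exact integral_sub ((hm a hf).integrable_slice hA x) ((hm a hg).integrable_slice hA x)

omit [Fintype ι] in
lemma OrthoFamily.partialIntegral_proj_sq_le (hu : OrthoFamily A u) (hf : Tame B f) (hA : A ⊆ B)
    (x : ι → ℝ) : partialIntegral A (fun x => proj A u f x ^ 2) x ≤
      partialIntegral A (fun x => f x ^ 2) x := by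
  classical
  set c : κ → ℝ := fun a => partialIntegral A (fun x => u a x * f x) x with hc
  set U : κ → (A → ℝ) → ℝ := fun a y => u a (Function.updateFinset x A y) with hU
  set F : (A → ℝ) → ℝ := fun y => f (Function.updateFinset x A y) with hF
  have hcoef : ∀ y, proj A u f (Function.updateFinset x A y) = ∑ a, c a * U a y := by
    intro y
    unfold proj
    refine Finset.sum_congr rfl fun a _ => ?_
    rw [mul_comm]
    congr 1
    exact (hu.tame_coeff hf hA a).congr_off Finset.sdiff_disjoint
      fun i hi => by simp [Function.updateFinset, hi]
  have hUU : ∀ a b, Integrable (fun y => U a y * U b y) volume := fun a b =>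
    ((hu.tame a).mul (hu.tame b)).integrable_slice subset_rfl x
  have hUF : ∀ a, Integrable (fun y => U a y * F y) volume := fun a =>
    ((hu.tame a).mul_disjoint_subset hf (Finset.union_eq_right.2 hA)).integrable_slice hA x
  have hFF : Integrable (fun y => F y ^ 2) volume := hf.sq.integrable_slice hA x
  have hPP : Integrable (fun y => (∑ a, c a * U a y) ^ 2) volume := by
    have := (hu.tame_proj hf hA).sq.integrable_slice hA x
    simpa only [hcoef] using this
  have hPF : Integrable (fun y => ∑ a, c a * (U a y * F y)) volume :=
    integrable_finsetSum _ fun a _ => (hUF a).const_mul _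
  have h1 : ∫ y, (∑ a, c a * U a y) ^ 2 ≤ ∑ a, c a ^ 2 := by
    have : ∀ y, (∑ a, c a * U a y) ^ 2 = ∑ a, ∑ b, (c a * c b) * (U a y * U b y) := by
      intro y
      rw [sq, Finset.sum_mul_sum]
      exact Finset.sum_congr rfl fun a _ => Finset.sum_congr rfl fun b _ => by ring
    simp_rw [this]
    rw [integral_finsetSum _ fun a _ => integrable_finsetSum _ fun b _ => (hUU a b).const_mul _]
    refine Finset.sum_le_sum fun a _ => ?_
    rw [integral_finsetSum _ fun b _ => (hUU a b).const_mul _]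
    simp_rw [integral_const_mul]
    rw [Finset.sum_eq_single a]
    · have := hu.norm_le a x
      change ∫ y, U a y * U a y ≤ 1 at this
      nlinarith [mul_self_nonneg (c a)]
    · intro b _ hb
      have := hu.ortho a b hb.symm x
      change ∫ y, U a y * U b y = 0 at this
      rw [this, mul_zero]
    · simp
  have h2 : ∫ y, ∑ a, c a * (U a y * F y) = ∑ a, c a ^ 2 := by
    rw [integral_finsetSum _ fun a _ => (hUF a).const_mul _]
    simp_rw [integral_const_mul]
    exact Finset.sum_congr rfl fun a _ => by rw [sq]; rfl
  -- expand `0 ≤ ‖f - P f‖²` on the slice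
  have h3 : 0 ≤ ∫ y, (F y ^ 2 - 2 * (∑ a, c a * (U a y * F y)) + (∑ a, c a * U a y) ^ 2) := by
    refine integral_nonneg fun y => ?_
    have : ∑ a, c a * (U a y * F y) = (∑ a, c a * U a y) * F y := by
      rw [Finset.sum_mul]; exact Finset.sum_congr rfl fun a _ => by ring
    simp only [Pi.zero_apply, this]
    nlinarith [sq_nonneg (F y - ∑ a, c a * U a y)]
  have h4 : Integrable (fun y => F y ^ 2 - 2 * ∑ a, c a * (U a y * F y)) volume :=
    hFF.sub (hPF.const_mul 2)
  rw [integral_add h4 hPP, integral_sub hFF (hPF.const_mul 2), integral_const_mul, h2] at h3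
  unfold partialIntegral
  simp_rw [hcoef]
  change ∫ y, (∑ a, c a * U a y) ^ 2 ≤ ∫ y, F y ^ 2
  linarith

/-- Bessel's inequality, applied in the variables of `A` with the others frozen. -/
lemma OrthoFamily.eLpNorm_proj_le (hu : OrthoFamily A u) (hf : Tame B f) (hA : A ⊆ B) :
    eLpNorm (proj A u f) 2 volume ≤ eLpNorm f 2 volume :=
  eLpNorm_two_le_of_partialIntegral_le (hu.tame_proj hf hA) hf hA
    (hu.partialIntegral_proj_sq_le hf hA)

end proj

/-! ### Gram–Schmidt for a semi-inner product -/

/-- Gram–Schmidt orthonormalization with respect to a positive semidefinite form: each vector is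
recovered from its coefficients up to a vector of norm zero. -/
lemma exists_orthonormal_or_zero {V : Type*} [AddCommGroup V] [Module ℝ V]
    (B : LinearMap.BilinForm ℝ V) (hsymm : ∀ x y, B x y = B y x) (hp : ∀ x, 0 ≤ B x x)
    (w : ℕ → V) (n : ℕ) :
    ∃ u : ℕ → V, (∀ a b, a ≠ b → B (u a) (u b) = 0) ∧
      (∀ a, B (u a) (u a) = 0 ∨ B (u a) (u a) = 1) ∧ (∀ a, n ≤ a → u a = 0) ∧
      ∀ b < n, B (w b - ∑ a ∈ Finset.range n, B (u a) (w b) • u a)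
        (w b - ∑ a ∈ Finset.range n, B (u a) (w b) • u a) = 0 := by
  have hnull : ∀ x, B x x = 0 → ∀ y, B x y = 0 := fun x hx y => by
    have h := B.apply_sq_le_of_symm hp ⟨fun x y => by simpa using hsymm x y⟩ x y
    rw [hx, zero_mul] at h
    exact pow_eq_zero_iff two_ne_zero |>.1 (le_antisymm h (sq_nonneg _))
  induction n with
  | zero => exact ⟨fun _ => 0, by simp, by simp, by simp, by simp⟩
  | succ n ih =>
    obtain ⟨u, hort, hnorm, hzero, hrec⟩ := ih
    set r := w n - ∑ a ∈ Finset.range n, B (u a) (w n) • u a with hr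
    have hur : ∀ a, B (u a) r = 0 := by
      intro a
      rcases hnorm a with h0 | h1
      · exact hnull _ h0 _
      · have han : a < n := by
          by_contra h
          rw [hzero a (not_lt.1 h)] at h1
          simp at h1
        rw [hr, map_sub, map_sum, Finset.sum_eq_single a]
        · simp [h1]
        · intro b _ hb
          simp [hort a b hb.symm]
        · intro h
          exact absurd (Finset.mem_range.2 han) h
    -- normalize the residual; the inverse square root is zero when the residual is null
    set c : ℝ := (√(B r r))⁻¹ with hc
    have hcc : c * c * B r r = 0 ∨ c * c * B r r = 1 := by
      rcases (hp r).eq_or_lt with h | h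
      · left; rw [← h, mul_zero]
      · right
        rw [hc, ← mul_inv, Real.mul_self_sqrt h.le, inv_mul_cancel₀ h.ne']
    have hun : u n = 0 := hzero n le_rfl
    set u' := Function.update u n (c • r) with hu'
    have hu'n : u' n = c • r := by simp [hu']
    have hu'a : ∀ a, a ≠ n → u' a = u a := fun a ha => by simp [hu', ha]
    have hsum : ∀ x, ∑ a ∈ Finset.range (n + 1), B (u' a) x • u' a =
        (∑ a ∈ Finset.range n, B (u a) x • u a) + (c * c * B r x) • r := by
      intro x
      rw [Finset.sum_range_succ, hu'n]
      congr 1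
      · refine Finset.sum_congr rfl fun a ha => ?_
        rw [hu'a a (Finset.mem_range.1 ha).ne]
      · simp only [map_smul, LinearMap.smul_apply, smul_eq_mul, smul_smul]
        ring_nf
    refine ⟨u', ?_, ?_, ?_, ?_⟩
    · intro a b hab
      by_cases ha : a = n
      · subst ha
        rw [hu'n, hu'a b hab.symm, map_smul, LinearMap.smul_apply, hsymm, hur, smul_zero]
      · by_cases hb : b = n
        · subst hb
          rw [hu'n, hu'a a ha, map_smul, hur, smul_zero]
        · rw [hu'a a ha, hu'a b hb, hort a b hab]
    · intro a
      by_cases ha : a = n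
      · subst ha
        rw [hu'n]
        simpa [mul_assoc] using hcc
      · rw [hu'a a ha]; exact hnorm a
    · intro a ha
      rw [hu'a a (by omega), hzero a (by omega)]
    · intro b hb
      rw [hsum]
      rcases Nat.lt_succ_iff_lt_or_eq.1 hb with hb | rfl
      · have h1 := hrec b hb
        set p := ∑ a ∈ Finset.range n, B (u a) (w b) • u a with hpdef
        have h2 : B r (w b) = 0 := by
          have h3 : B r (w b - p) = 0 := by rw [hsymm]; exact hnull _ h1 _
          have h4 : B r p = 0 := by
            rw [hpdef, map_sum]
            exact Finset.sum_eq_zero fun a _ => by rw [map_smul, hsymm r, hur, smul_zero]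
          rw [map_sub, h4, sub_zero] at h3
          exact h3
        rw [h2]
        simpa using h1
      · have h1 : B r (w b) = B r r := by
          conv_rhs => rw [hr, map_sub, map_sum]
          rw [← hr, Finset.sum_eq_zero, sub_zero]
          exact fun a _ => by rw [map_smul, hsymm r, hur, smul_zero]
        rw [h1]
        have h2 : w b - (∑ a ∈ Finset.range b, B (u a) (w b) • u a + (c * c * B r r) • r) =
            (1 - c * c * B r r) • r := by
          rw [hr]; module
        rw [h2]
        rcases (hp r).eq_or_lt with h | h
        · simp [← h]
        · have : c * c * B r r = 1 := by
            rw [hc, ← mul_inv, Real.mul_self_sqrt h.le, inv_mul_cancel₀ h.ne']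
          simp [this]

variable {ι : Type*} [Fintype ι] [DecidableEq ι] {A B : Finset ι} {f : (ι → ℝ) → ℝ}

/-- Tame functions of the variables in `A`, as a vector space. -/
def tameSubmodule (A : Finset ι) : Submodule ℝ ((ι → ℝ) → ℝ) where
  carrier := {f | Tame A f}
  add_mem' hf hg := Tame.add hf hg
  zero_mem' := Tame.zero A
  smul_mem' c _ hf := Tame.const_mul c hf

/-- The `L²(ℝ^A)` inner product. -/
noncomputable def tameInner (A : Finset ι) : LinearMap.BilinForm ℝ (tameSubmodule A) :=
  LinearMap.mk₂ ℝ (fun f g => partialIntegral A (fun x => f.1 x * g.1 x) 0)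
    (fun f f' g => by
      have := partialIntegral_add (Tame.mul f.2 g.2) (Tame.mul f'.2 g.2) subset_rfl 0
      simpa [add_mul] using this)
    (fun c f g => by
      have := partialIntegral_const_mul (B := A) c (fun x => f.1 x * g.1 x) 0
      simpa [mul_assoc] using this)
    (fun f g g' => by
      have := partialIntegral_add (Tame.mul f.2 g.2) (Tame.mul f.2 g'.2) subset_rfl 0
      simpa [mul_add] using this)
    (fun c f g => by
      have := partialIntegral_const_mul (B := A) c (fun x => f.1 x * g.1 x) 0
      simpa [mul_left_comm] using this)

omit [Fintype ι] in
lemma tameInner_apply (f g : tameSubmodule A) :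
    tameInner A f g = partialIntegral A (fun x => f.1 x * g.1 x) 0 := rfl

omit [Fintype ι] in
lemma Tame.partialIntegral_eq (hf : Tame A f) (x y : ι → ℝ) :
    GaussianTTN.partialIntegral A f x = GaussianTTN.partialIntegral A f y :=
  (hf.partialIntegral subset_rfl).dependsOn (by simp)

omit [Fintype ι] in
/-- Every finite family of tame functions is spanned, up to null functions, by an orthonormal
family of the same length. -/
lemma exists_orthoFamily (n : ℕ) (w : Fin n → (ι → ℝ) → ℝ) (hw : ∀ b, Tame A (w b)) :
    ∃ u : Fin n → (ι → ℝ) → ℝ, OrthoFamily A u ∧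
      ∀ b x, partialIntegral A (fun x => (w b x - proj A u (w b) x) ^ 2) x = 0 := by
  obtain ⟨u, hort, hnorm, -, hrec⟩ := exists_orthonormal_or_zero (tameInner A)
    (fun f g => by simp only [tameInner_apply, mul_comm])
    (fun f => partialIntegral_nonneg (fun x => mul_self_nonneg _) 0)
    (fun b => if h : b < n then ⟨w ⟨b, h⟩, hw _⟩ else 0) n
  have hu : OrthoFamily A (fun a : Fin n => (u a).1) := by
    refine ⟨fun a => (u a).2, fun a b hab x => ?_, fun a x => ?_⟩
    · rw [Tame.partialIntegral_eq (Tame.mul (u a).2 (u b).2) x 0]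
      exact hort a b (Fin.val_ne_of_ne hab)
    · rw [Tame.partialIntegral_eq (Tame.mul (u a).2 (u a).2) x 0]
      rcases hnorm a with h | h
      · exact (show _ = _ from h).trans_le zero_le_one
      · exact (show _ = _ from h).le
  refine ⟨_, hu, fun b x => ?_⟩
  rw [Tame.partialIntegral_eq ((hw b).sub (hu.tame_proj (hw b) subset_rfl)).sq x 0]
  have h := hrec b b.2
  simp only [b.2, dite_true] at h
  rw [← h]
  have hval : ∀ x, w b x - proj A (fun a : Fin n => (u a).1) (w b) x =
      ((⟨w b, hw b⟩ : tameSubmodule A) -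
        ∑ a ∈ Finset.range n, tameInner A (u a) ⟨w b, hw b⟩ • u a).1 x := by
    intro x
    rw [Finset.sum_range]
    simp only [Submodule.coe_sub, Submodule.coe_sum, Submodule.coe_smul, Pi.sub_apply,
      Finset.sum_apply, Pi.smul_apply, smul_eq_mul]
    congr 1
    refine Finset.sum_congr rfl fun a _ => ?_
    rw [mul_comm, Tame.partialIntegral_eq (Tame.mul (u a).2 (hw b)) x 0]
    rfl
  rw [tameInner_apply]
  simp_rw [hval, sq]

/-! ### Separation rank across a bipartition -/

/-- `f` is a sum of `n` products of a function of the variables in `A` with a function of the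
other variables. -/
def SepRank (A : Finset ι) (n : ℕ) (f : (ι → ℝ) → ℝ) : Prop :=
  ∃ u v : Fin n → (ι → ℝ) → ℝ, (∀ a, Tame A (u a)) ∧ (∀ a, Tame Aᶜ (v a)) ∧
    ∀ x, f x = ∑ a, u a x * v a x

lemma SepRank.tame {n : ℕ} (h : SepRank A n f) : Tame Finset.univ f := by
  obtain ⟨u, v, hu, hv, hf⟩ := h
  rw [show f = fun x => ∑ a, u a x * v a x from funext hf]
  exact Tame.sum _ fun a _ => (hu a).mul_disjoint_subset (hv a) (Finset.union_compl A)

lemma SepRank.compl {n : ℕ} (h : SepRank A n f) : SepRank Aᶜ n f := by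
  obtain ⟨u, v, hu, hv, hf⟩ := h
  exact ⟨v, u, hv, by simpa using hu, fun x => by simp_rw [hf x, mul_comm]⟩

lemma SepRank.of_fintype {κ : Type*} [Fintype κ] {n : ℕ} (hn : Fintype.card κ ≤ n)
    {u v : κ → (ι → ℝ) → ℝ} (hu : ∀ a, Tame A (u a)) (hv : ∀ a, Tame Aᶜ (v a))
    (hf : ∀ x, f x = ∑ a, u a x * v a x) : SepRank A n f := by
  classical
  obtain ⟨e⟩ := Function.Embedding.nonempty_of_card_le (α := κ) (β := Fin n) (by simpa using hn)
  have hinj := e.injective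
  let g : (κ → (ι → ℝ) → ℝ) → Fin n → (ι → ℝ) → ℝ := fun u a =>
    if h : ∃ k, e k = a then u h.choose else fun _ => 0
  have hg : ∀ u k, g u (e k) = u k := fun u k => by
    have h : ∃ k', e k' = e k := ⟨k, rfl⟩
    simp only [g, h, dite_true]
    rw [hinj h.choose_spec]
  have hg0 : ∀ u a, (¬ ∃ k, e k = a) → g u a = fun _ => 0 := fun u a h => by
    simp only [g, h, dite_false]
  refine ⟨g u, g v, fun a => ?_, fun a => ?_, fun x => ?_⟩
  · by_cases h : ∃ k, e k = a
    · obtain ⟨k, rfl⟩ := h; rw [hg]; exact hu k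
    · rw [hg0 _ _ h]; exact Tame.zero A
  · by_cases h : ∃ k, e k = a
    · obtain ⟨k, rfl⟩ := h; rw [hg]; exact hv k
    · rw [hg0 _ _ h]; exact Tame.zero _
  · rw [hf x, ← Finset.sum_subset (Finset.subset_univ (Finset.univ.map e)), Finset.sum_map]
    · exact Finset.sum_congr rfl fun k _ => by rw [hg, hg]
    · intro a _ ha
      rw [hg0 u a fun ⟨k, hk⟩ => ha (by simp [← hk])]
      simp

lemma SepRank.empty {n : ℕ} (hn : 1 ≤ n) (hf : Tame Finset.univ f) : SepRank ∅ n f :=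
  SepRank.of_fintype (κ := Unit) (by simpa using hn) (u := fun _ _ => 1) (v := fun _ => f)
    (fun _ => Tame.const 1) (fun _ => by simpa using hf) (fun x => by simp)

lemma OrthoFamily.sepRank_proj {n : ℕ} {u : Fin n → (ι → ℝ) → ℝ} (hu : OrthoFamily A u)
    (hf : Tame Finset.univ f) : SepRank A n (proj A u f) :=
  ⟨u, fun a => partialIntegral A (fun x => u a x * f x), hu.tame, fun a => by
    simpa [Finset.compl_eq_univ_sdiff] using hu.tame_coeff hf (Finset.subset_univ _) a,
    fun _ => rfl⟩

/-- A projection acting inside one part of a bipartition does not increase the separation rank. -/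
lemma SepRank.proj_of_subset {κ : Type*} [Fintype κ] {u : κ → (ι → ℝ) → ℝ} {n : ℕ}
    (hu : OrthoFamily A u) (hf : SepRank B n f) (hAB : A ⊆ B) : SepRank B n (proj A u f) := by
  obtain ⟨w, v, hw, hv, hf⟩ := hf
  refine ⟨fun b => proj A u (w b), v, fun b => hu.tame_proj (hw b) hAB, hv, fun x => ?_⟩
  rw [show f = fun x => ∑ b, v b x * w b x from
    funext fun x => by simp_rw [hf x, mul_comm]]
  rw [hu.proj_sum (B := Finset.univ) _ (fun b _ => (hv b).mul_disjoint_subset (hw b)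
    (by rw [Finset.union_comm, Finset.union_compl])) (Finset.subset_univ _)]
  refine Finset.sum_congr rfl fun b _ => ?_
  rw [proj_mul_left ((hv b).congr_off _), mul_comm]
  exact (disjoint_compl_left (a := B)).mono_right hAB

lemma SepRank.proj_of_disjoint {κ : Type*} [Fintype κ] {u : κ → (ι → ℝ) → ℝ} {n : ℕ}
    (hu : OrthoFamily A u) (hf : SepRank B n f) (hAB : Disjoint A B) :
    SepRank B n (proj A u f) := by
  have := (hf.compl.proj_of_subset hu (Finset.subset_compl_iff_disjoint_right.2 hAB)).compl
  rwa [compl_compl] at this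

lemma exists_proj_ae_eq {n : ℕ} (hf : SepRank A n f) :
    ∃ u : Fin n → (ι → ℝ) → ℝ, OrthoFamily A u ∧ proj A u f =ᵐ[volume] f := by
  obtain ⟨w, v, hw, hv, hfw⟩ := hf
  obtain ⟨u, hu, hnull⟩ := exists_orthoFamily n w hw
  refine ⟨u, hu, ?_⟩
  have hae : ∀ b, ∀ᵐ x ∂(volume : Measure (ι → ℝ)), proj A u (w b) x = w b x := by
    intro b
    set d : (ι → ℝ) → ℝ := fun x => w b x - proj A u (w b) x with hd
    have hdt : Tame A d := (hw b).sub (hu.tame_proj (hw b) subset_rfl)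
    have h0 : ∫⁻ x, ENNReal.ofReal (d x ^ 2) = ∫⁻ x : ι → ℝ, 0 := by
      refine lintegral_eq_of_lmarginal_eq (μ := fun _ => volume) A
        hdt.sq.measurable.ennreal_ofReal measurable_const ?_
      ext x
      rw [lmarginal_ofReal hdt.sq (fun x => sq_nonneg _) subset_rfl, hnull b x]
      simp [lmarginal]
    rw [lintegral_zero, lintegral_eq_zero_iff hdt.sq.measurable.ennreal_ofReal] at h0
    filter_upwards [h0] with x hx
    have : d x ^ 2 ≤ 0 := by simpa using hx
    have : d x = 0 := pow_eq_zero_iff two_ne_zero |>.1 (le_antisymm this (sq_nonneg _))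
    rw [hd] at this
    linarith
  filter_upwards [ae_all_iff.2 hae] with x hx
  rw [show f = fun x => ∑ b, v b x * w b x from
    funext fun x => by simp_rw [hfw x, mul_comm]]
  rw [hu.proj_sum (B := Finset.univ) _ (fun b _ => (hv b).mul_disjoint_subset (hw b)
    (by rw [Finset.union_comm, Finset.union_compl])) (Finset.subset_univ _)]
  refine Finset.sum_congr rfl fun b _ => ?_
  rw [proj_mul_left ((hv b).congr_off disjoint_compl_left), hx b]

/-! ### Simultaneous approximation across a laminar family of bipartitions -/

/-- If `f` is within `δ` of having separation rank `n` across each set of a laminar family, some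
function within `2 * δ` times the size of the family has rank `n` across all of them: project in the
variables of one set after another, larger sets first, so that later projections do not spoil the
ranks already obtained. -/
lemma exists_sepRank_of_laminar {n : ℕ} {δ : ENNReal} (hf : Tame Finset.univ f)
    (𝒜 : Finset (Finset ι))
    (hlam : ∀ A ∈ 𝒜, ∀ B ∈ 𝒜, A ⊆ B ∨ B ⊆ A ∨ Disjoint A B)
    (happ : ∀ A ∈ 𝒜, ∃ g, SepRank A n g ∧ eLpNorm (fun x => f x - g x) 2 volume ≤ δ) :
    ∃ g, Tame Finset.univ g ∧ (∀ A ∈ 𝒜, SepRank A n g) ∧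
      eLpNorm (fun x => f x - g x) 2 volume ≤ 2 * 𝒜.card * δ := by
  revert hlam happ
  refine Finset.induction_on_min_value (α := ℕ) (ι := Finset ι) Finset.card 𝒜 ?_ ?_
  · exact fun _ _ => ⟨f, hf, by simp, by simp⟩
  · intro A 𝒜 hA hmin ih hlam happ
    obtain ⟨g, hg, hgr, hgd⟩ := ih
      (fun A hA B hB => hlam A (Finset.mem_insert_of_mem hA) B (Finset.mem_insert_of_mem hB))
      (fun A hA => happ A (Finset.mem_insert_of_mem hA))
    obtain ⟨h, hh, hhd⟩ := happ A (Finset.mem_insert_self _ _)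
    obtain ⟨u, hu, huh⟩ := exists_proj_ae_eq hh
    refine ⟨proj A u g, hu.tame_proj hg (Finset.subset_univ _), ?_, ?_⟩
    · intro B hB
      rcases Finset.mem_insert.1 hB with rfl | hB
      · exact hu.sepRank_proj hg
      · rcases hlam A (Finset.mem_insert_self _ _) B (Finset.mem_insert_of_mem hB) with h1 | h1 | h1
        · exact (hgr B hB).proj_of_subset hu h1
        · rw [Finset.eq_of_subset_of_card_le h1 (hmin B hB)]
          exact hu.sepRank_proj hg
        · exact (hgr B hB).proj_of_disjoint hu h1
    · -- `f - P g = (f - h) + P (h - f) + P (f - g)` almost everywhere, since `P h = h`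
      have hAU := Finset.subset_univ A
      have e : (fun x => f x - proj A u g x) =ᵐ[volume]
          ((fun x => f x - h x) + proj A u (fun x => h x - f x)) +
            proj A u (fun x => f x - g x) := by
        filter_upwards [huh] with x hx
        simp only [Pi.add_apply]
        rw [hu.proj_sub hh.tame hf hAU, hu.proj_sub hf hg hAU, hx]
        ring
      have m1 := (hf.sub hh.tame).measurable.aestronglyMeasurable (μ := volume)
      have m2 := (hu.tame_proj (hh.tame.sub hf) hAU).measurable.aestronglyMeasurable (μ := volume)
      have m3 := (hu.tame_proj (hf.sub hg) hAU).measurable.aestronglyMeasurable (μ := volume)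
      have hsymm : eLpNorm (fun x => h x - f x) 2 volume ≤ δ := by
        have : (fun x => h x - f x) = -(fun x => f x - h x) := by ext; simp
        rw [this, eLpNorm_neg]
        exact hhd
      calc eLpNorm (fun x => f x - proj A u g x) 2 volume
          ≤ (δ + δ) + 2 * 𝒜.card * δ := by
            rw [eLpNorm_congr_ae e]
            refine (eLpNorm_add_le (m1.add m2) m3 one_le_two).trans (add_le_add
              ((eLpNorm_add_le m1 m2 one_le_two).trans (add_le_add hhd ?_)) ?_)
            · exact (hu.eLpNorm_proj_le (hh.tame.sub hf) hAU).trans hsymm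
            · exact (hu.eLpNorm_proj_le (hf.sub hg) hAU).trans hgd
        _ = 2 * (insert A 𝒜).card * δ := by
            rw [Finset.card_insert_of_notMem hA]
            push_cast
            ring

/-- A nonempty member of a laminar family on `Fin D` is determined by its least element and its
size. -/
lemma card_le_of_laminar {D : ℕ} (𝒜 : Finset (Finset (Fin D)))
    (hlam : ∀ A ∈ 𝒜, ∀ B ∈ 𝒜, A ⊆ B ∨ B ⊆ A ∨ Disjoint A B)
    (hne : ∀ A ∈ 𝒜, A.Nonempty) : 𝒜.card ≤ D * D := by
  classical
  rcases Nat.eq_zero_or_pos D with rfl | hD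
  · rw [Finset.card_eq_zero.2 (Finset.eq_empty_of_forall_notMem fun A hA =>
      Fin.elim0 (hne A hA).choose)]
  let φ : Finset (Fin D) → Fin D × ℕ := fun A =>
    (if h : A.Nonempty then A.min' h else ⟨0, hD⟩, A.card)
  have hcard : (Finset.univ ×ˢ Finset.Icc 1 D : Finset (Fin D × ℕ)).card = D * D := by simp
  rw [← hcard]
  refine Finset.card_le_card_of_injOn φ ?_ ?_
  · intro A hA
    have h1 := (hne A hA).card_pos
    have h2 := Finset.card_le_univ A
    simp only [Fintype.card_fin] at h2
    simp [φ, h2, Nat.one_le_iff_ne_zero, h1.ne']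
  · intro A hA B hB hAB
    have hA' := hne A hA
    have hB' := hne B hB
    simp only [φ, hA', hB', dite_true, Prod.mk.injEq] at hAB
    rcases hlam A hA B hB with h | h | h
    · exact Finset.eq_of_subset_of_card_le h hAB.2.ge
    · exact (Finset.eq_of_subset_of_card_le h hAB.2.le).symm
    · exact absurd (hAB.1 ▸ B.min'_mem hB') (Finset.disjoint_left.1 h (A.min'_mem hA'))

/-! ### The two sides of an edge of a tree -/

section Tree

variable {V : Type*} {G : SimpleGraph V} {u v p q y z o : V}

/-- `OnSide G u v z` says that `z` is still connected to `u` after deleting the edge `uv`. -/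
def OnSide (G : SimpleGraph V) (u v z : V) : Prop :=
  (G.deleteEdges {s(u, v)}).Reachable u z

lemma OnSide.refl (G : SimpleGraph V) (u v : V) : OnSide G u v u := SimpleGraph.Reachable.refl _

lemma not_onSide_other (hG : G.IsAcyclic) (h : G.Adj u v) : ¬ OnSide G u v v :=
  SimpleGraph.isBridge_iff.1 (SimpleGraph.isAcyclic_iff_forall_adj_isBridge.1 hG h)

lemma OnSide.step (hz : OnSide G u v z) (hzy : G.Adj z y) (hne : s(z, y) ≠ s(u, v)) :
    OnSide G u v y :=
  hz.trans (SimpleGraph.Adj.reachable (by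
    rw [SimpleGraph.deleteEdges_adj]
    exact ⟨hzy, hne⟩))

lemma OnSide.not_symm (hG : G.IsAcyclic) (h : G.Adj u v) (hz : OnSide G u v z) :
    ¬ OnSide G v u z := fun hz' => by
  rw [OnSide, Sym2.eq_swap] at hz'
  exact not_onSide_other hG h (SimpleGraph.Reachable.trans hz hz'.symm)

lemma onSide_or (hG : G.Connected) (u v z : V) : OnSide G u v z ∨ OnSide G v u z := by
  have h := SimpleGraph.reachable_iff_reflTransGen u z |>.1 (hG.preconnected u z)
  induction h with
  | refl => exact Or.inl (OnSide.refl G u v)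
  | @tail b c _ hbc ih =>
    by_cases he : s(b, c) = s(u, v)
    · rcases Sym2.eq_iff.1 he with ⟨-, rfl⟩ | ⟨-, rfl⟩
      · exact Or.inr (OnSide.refl G _ _)
      · exact Or.inl (OnSide.refl G _ _)
    · rcases ih with ih | ih
      · exact Or.inl (ih.step hbc he)
      · exact Or.inr (ih.step hbc (by rwa [Sym2.eq_swap (a := v)]))

/-- A side of one edge stays connected when an edge not contained in it is deleted. -/
lemma OnSide.reachable_deleteEdges (hp : ¬ OnSide G u v p) (hz : OnSide G u v z) :
    (G.deleteEdges {s(p, q)}).Reachable u z := by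
  have h := SimpleGraph.reachable_iff_reflTransGen u z |>.1 hz
  have key : OnSide G u v z ∧ (G.deleteEdges {s(p, q)}).Reachable u z := by
    clear hz
    induction h with
    | refl => exact ⟨OnSide.refl G u v, SimpleGraph.Reachable.refl _⟩
    | @tail b c _ hbc ih =>
      have hc : OnSide G u v c := SimpleGraph.Reachable.trans ih.1 hbc.reachable
      refine ⟨hc, ih.2.trans (SimpleGraph.Adj.reachable ?_)⟩
      rw [SimpleGraph.deleteEdges_adj] at hbc ⊢
      refine ⟨hbc.1, fun he => hp ?_⟩
      rcases Sym2.eq_iff.1 (Set.mem_singleton_iff.1 he) with ⟨rfl, -⟩ | ⟨-, rfl⟩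
      · exact ih.1
      · exact hc
  exact key.2

lemma OnSide.subset_of_inter (hp : ¬ OnSide G u v p ∨ ¬ OnSide G u v q)
    (hz : OnSide G u v z) (hz' : OnSide G p q z) (hy : OnSide G u v y) : OnSide G p q y := by
  have h : ∀ {y}, OnSide G u v y → (G.deleteEdges {s(p, q)}).Reachable u y := fun hy => by
    rcases hp with hp | hq
    · exact hy.reachable_deleteEdges hp
    · rw [Sym2.eq_swap]; exact hy.reachable_deleteEdges hq
  exact (SimpleGraph.Reachable.trans hz' (h hz).symm).trans (h hy)

/-- The sides that avoid a fixed root form a laminar family. -/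
lemma onSide_laminar (hG : G.IsTree) (huv : G.Adj u v) (ho : ¬ OnSide G u v o)
    (ho' : ¬ OnSide G p q o) :
    (∀ z, OnSide G u v z → OnSide G p q z) ∨ (∀ z, OnSide G p q z → OnSide G u v z) ∨
      ∀ z, OnSide G u v z → ¬ OnSide G p q z := by
  by_cases hpq : OnSide G u v p ∧ OnSide G u v q
  · refine Or.inr (Or.inl fun z hz => ?_)
    by_contra hzu
    have hz' := (onSide_or hG.connected u v z).resolve_left hzu
    have hov := (onSide_or hG.connected u v o).resolve_left ho
    exact ho' (OnSide.subset_of_inter (Or.inl (hpq.1.not_symm hG.isAcyclic huv)) hz' hz hov)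
  · by_cases hd : ∀ z, OnSide G u v z → ¬ OnSide G p q z
    · exact Or.inr (Or.inr hd)
    · push Not at hd
      obtain ⟨z, hz, hz'⟩ := hd
      exact Or.inl fun y hy => OnSide.subset_of_inter (not_and_or.1 hpq) hz hz' hy

end Tree

section Side

variable {D : ℕ} {V : Type*} (T : TreeShape D V) {u v : V}

lemma mem_side {i : Fin D} : i ∈ T.side u v ↔ OnSide T.graph u v (T.site i) := by
  simp [TreeShape.side, OnSide]

lemma side_compl (h : T.graph.Adj u v) : T.side v u = (T.side u v)ᶜ := by
  ext i
  rw [Finset.mem_compl, mem_side, mem_side]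
  refine ⟨fun hi => hi.not_symm T.isTree.isAcyclic h.symm, fun hi => ?_⟩
  exact (onSide_or T.isTree.connected u v _).resolve_left hi

end Side

/-! ### From separation ranks to a tree tensor network -/

section Exact

variable {ι : Type*} [Fintype ι] [DecidableEq ι] {A B : Finset ι} {f g : (ι → ℝ) → ℝ}

lemma OrthoFamily.proj_congr_ae {κ : Type*} [Fintype κ] {u : κ → (ι → ℝ) → ℝ}
    (hu : OrthoFamily A u) (hf : Tame Finset.univ f) (hg : Tame Finset.univ g)
    (h : f =ᵐ[volume] g) : proj A u f =ᵐ[volume] proj A u g := by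
  have hA := Finset.subset_univ A
  have hfg := hf.sub hg
  have h1 := hu.eLpNorm_proj_le hfg hA
  have h2 : eLpNorm (fun x => f x - g x) 2 volume = 0 := by
    rw [eLpNorm_eq_zero_iff hfg.measurable.aestronglyMeasurable two_ne_zero]
    filter_upwards [h] with x hx
    simp [hx]
  rw [h2, nonpos_iff_eq_zero, eLpNorm_eq_zero_iff
    (hu.tame_proj hfg hA).measurable.aestronglyMeasurable two_ne_zero] at h1
  filter_upwards [h1] with x hx
  rw [hu.proj_sub hf hg hA] at hx
  simpa [sub_eq_zero] using hx

/-- The product over `r ∈ s` of functions of the variables located at `r`. -/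
lemma Tame.prod_fiber {V : Type*} [DecidableEq V] (σ : ι → V) (s : Finset V)
    {g : V → (ι → ℝ) → ℝ} (hg : ∀ r ∈ s, Tame (Finset.univ.filter (σ · = r)) (g r)) :
    Tame (Finset.univ.filter (σ · ∈ s)) (fun x => ∏ r ∈ s, g r x) := by
  induction s using Finset.induction_on with
  | empty => simpa using Tame.const (ι := ι) 1
  | insert a s ha ih =>
    simp only [Finset.prod_insert ha]
    refine (hg a (by simp)).mul_disjoint_subset (ih fun r hr => hg r (by simp [hr])) ?_
    ext i
    simp

/-- Summing over an index and a further value, or over the index alone with that value read off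
from one of its entries, differs by the number of values when the summand ignores the entry. -/
lemma sum_sum_eq_card_mul_sum {E F : Type*} [Fintype E] [DecidableEq E] [Fintype F] (e : E)
    (h : (E → F) → F → ℝ) (hh : ∀ α b b', h (Function.update α e b') b = h α b) :
    ∑ α, ∑ b, h α b = ∑ α, Fintype.card F * h α (α e) := by
  let φ : (E → F) × F → (E → F) × F := fun p => (Function.update p.1 e p.2, p.1 e)
  have hφ : Function.Involutive φ := fun p => by
    simp only [φ, Function.update_idem, Function.update_eq_self, Function.update_self]
  have h1 : ∑ p : (E → F) × F, h p.1 p.2 = ∑ p : (E → F) × F, h p.1 (p.1 e) := by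
    rw [← Equiv.sum_comp hφ.toPerm]
    exact Finset.sum_congr rfl fun p _ => hh p.1 (p.1 e) p.2
  rw [Fintype.sum_prod_type, Fintype.sum_prod_type] at h1
  simpa only [Finset.sum_const, Finset.card_univ, nsmul_eq_mul] using h1

variable {D : ℕ} {V : Type*} [DecidableEq V] (T : TreeShape D V)

/-- `f` is represented by the network obtained from `T` by keeping only the vertices in the
connected set `R`; `σ` moves every variable to the vertex of `R` closest to its site.
The first three conditions describe `R` and `σ`; the others give local tensors `g r` depending on
the virtual indices inside `R` at `r`. Virtual indices outside `R` are summed over as well, without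
occurring in the summand. -/
def PartialNetwork [Fintype T.Edge] [DecidableEq T.Edge] (n : ℕ) (f : (Fin D → ℝ) → ℝ)
    (R : Finset V) : Prop :=
  R.Nonempty ∧
  (∀ w₀ ∈ R, ∀ w, w ∉ R → T.graph.Adj w w₀ → ∀ r ∈ R, ¬ OnSide T.graph w w₀ r) ∧
  ∃ σ : Fin D → V, (∀ i, σ i ∈ R) ∧
    (∀ w₀ ∈ R, ∀ w, w ∉ R → T.graph.Adj w w₀ → ∀ i ∈ T.side w w₀, σ i = w₀) ∧
    (∀ i, T.site i ∈ R → σ i = T.site i) ∧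
  ∃ g : V → (T.Edge → Fin n) → (Fin D → ℝ) → ℝ,
    (∀ r ∈ R, ∀ α, Tame (Finset.univ.filter (σ · = r)) (g r α)) ∧
    (∀ r ∈ R, DependsOn (g r) {e | r ∈ e.1 ∧ ∀ v ∈ e.1, v ∈ R}) ∧
    f =ᵐ[volume] fun x => ∑ α, ∏ r ∈ R, g r α x

variable {T} [Fintype T.Edge] [DecidableEq T.Edge] {n : ℕ} {f : (Fin D → ℝ) → ℝ}

lemma PartialNetwork.singleton (hn : 1 ≤ n) (hf : Tame Finset.univ f) (o : V) :
    PartialNetwork T n f {o} := by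
  have : Nonempty (Fin n) := ⟨⟨0, hn⟩⟩
  refine ⟨by simp, ?_, fun _ => o, by simp, ?_, ?_,
    fun _ _ x => (Fintype.card (T.Edge → Fin n) : ℝ)⁻¹ * f x, ?_, ?_, ?_⟩
  · intro w₀ hw₀ w _ h r hr
    rw [Finset.mem_singleton] at hw₀ hr
    subst hw₀ hr
    exact not_onSide_other T.isTree.isAcyclic h
  · intro w₀ hw₀ w _ _ i _
    exact (Finset.mem_singleton.1 hw₀).symm
  · intro i hi
    exact (Finset.mem_singleton.1 hi).symm
  · intro r hr α
    rw [Finset.mem_singleton] at hr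
    simpa [hr] using hf.const_mul _
  · intro r _ α β _
    rfl
  · refine Filter.Eventually.of_forall fun x => ?_
    have hc : (Fintype.card (T.Edge → Fin n) : ℝ) ≠ 0 :=
      Nat.cast_ne_zero.2 Fintype.card_ne_zero
    simp only [Finset.prod_singleton, Finset.sum_const, Finset.card_univ, nsmul_eq_mul]
    rw [mul_inv_cancel_left₀ hc]

/-- Splitting off one more vertex `w`, adjacent to `w₀ ∈ R`: since `f` is reproduced by the
projection on the side of `w`, the tensor at `w₀` may be expanded in the orthonormal family of that
side. -/
lemma PartialNetwork.grow {R : Finset V} (hR : PartialNetwork T n f R)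
    (hf : Tame Finset.univ f) {w w₀ : V} (hw₀ : w₀ ∈ R) (hw : w ∉ R) (hadj : T.graph.Adj w w₀)
    (hrank : SepRank (T.side w w₀) n f) : PartialNetwork T n f (insert w R) := by
  obtain ⟨hne, hconn, σ, hσR, hσside, hσsite, g, hgt, hgd, hfg⟩ := hR
  have hac := T.isTree.isAcyclic
  have hww₀ : w ≠ w₀ := hadj.ne
  obtain ⟨u, hu, hproj⟩ := exists_proj_ae_eq hrank
  set A := T.side w w₀ with hA
  have hmemA : ∀ {i}, i ∈ A ↔ OnSide T.graph w w₀ (T.site i) := fun {i} => mem_side T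
  let e₀ : T.Edge := ⟨s(w, w₀), hadj⟩
  have hsub : ∀ z, z ∉ R → T.graph.Adj z w → ∀ y, OnSide T.graph z w y →
      OnSide T.graph w w₀ y := by
    intro z hz hzw y hy
    have hne : s(w, z) ≠ s(w, w₀) := fun h => by
      rcases Sym2.eq_iff.1 h with ⟨-, h⟩ | ⟨h, -⟩
      · exact hz (h ▸ hw₀)
      · exact hww₀ h
    exact OnSide.subset_of_inter (Or.inl (not_onSide_other hac hzw)) (OnSide.refl _ _ _)
      ((OnSide.refl _ _ _).step hzw.symm hne) hy
  have hwz : ∀ z₀ ∈ R, ∀ z, z ∉ insert w R → T.graph.Adj z z₀ → ¬ OnSide T.graph z z₀ w := by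
    intro z₀ hz₀ z hz hzz₀ h
    rw [Finset.mem_insert, not_or] at hz
    refine hconn z₀ hz₀ z hz.2 hzz₀ w₀ hw₀ (h.step hadj fun he => ?_)
    rcases Sym2.eq_iff.1 he with ⟨h1, -⟩ | ⟨h1, -⟩
    · exact hz.1 h1.symm
    · exact hw (h1 ▸ hz₀)
  let σ' : Fin D → V := fun i => if i ∈ A then w else σ i
  have hfib : Finset.univ.filter (σ' · = w) = A := by
    ext i
    by_cases hi : i ∈ A
    · simp [σ', hi]
    · have : σ i ≠ w := fun h => hw (h ▸ hσR i)
      simp [σ', hi, this]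
  have hfib₀ : Finset.univ.filter (σ' · = w₀) = Finset.univ.filter (σ · = w₀) \ A := by
    ext i
    by_cases hi : i ∈ A <;> simp [σ', hi, hww₀]
  have hAσ : A ⊆ Finset.univ.filter (σ · = w₀) := fun i hi => by
    simpa using hσside w₀ hw₀ w hw hadj i hi
  have hfib' : ∀ r ∈ R, r ≠ w₀ →
      Finset.univ.filter (σ' · = r) = Finset.univ.filter (σ · = r) := by
    intro r hr hrw₀
    ext i
    by_cases hi : i ∈ A
    · have h1 : σ i = w₀ := hσside w₀ hw₀ w hw hadj i hi
      have h2 : w ≠ r := fun h => hw (h ▸ hr)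
      simp [σ', hi, h1, h2, hrw₀.symm]
    · simp [σ', hi]
  let c : (T.Edge → Fin n) → Fin n → (Fin D → ℝ) → ℝ := fun α b x =>
    partialIntegral A (fun x => u b x * g w₀ α x) x
  -- The old tensors ignore the index on the new edge, so summing over it multiplied every term
  -- by `n`. As that index now labels the expansion, the factor `n` has to be put in by hand.
  let g' : V → (T.Edge → Fin n) → (Fin D → ℝ) → ℝ := fun r α =>
    if r = w then u (α e₀) else if r = w₀ then fun x => n * c α (α e₀) x else g r α
  have hg'w : ∀ α, g' w α = u (α e₀) := fun α => by simp [g']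
  have hg'w₀ : ∀ α, g' w₀ α = fun x => n * c α (α e₀) x := fun α => by simp [g', hww₀.symm]
  have hg' : ∀ r ∈ R, r ≠ w₀ → ∀ α, g' r α = g r α := fun r hr hr₀ α => by
    have : r ≠ w := fun h => hw (h ▸ hr)
    simp [g', this, hr₀]
  refine ⟨by simp, ?_, σ', ?_, ?_, ?_, g', ?_, ?_, ?_⟩
  · intro z₀ hz₀ z hz hadj' r hr
    have hz' := hz
    rw [Finset.mem_insert, not_or] at hz'
    rcases Finset.mem_insert.1 hz₀ with rfl | hz₀R
    · rcases Finset.mem_insert.1 hr with rfl | hr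
      · exact not_onSide_other hac hadj'
      · exact fun h => hconn w₀ hw₀ _ hw hadj r hr (hsub z hz'.2 hadj' r h)
    · rcases Finset.mem_insert.1 hr with rfl | hr
      · exact hwz z₀ hz₀R z hz hadj'
      · exact hconn z₀ hz₀R z hz'.2 hadj' r hr
  · intro i
    by_cases hi : i ∈ A
    · simp [σ', hi]
    · simp [σ', hi, hσR i]
  · intro z₀ hz₀ z hz hadj' i hi
    have hz' := hz
    rw [Finset.mem_insert, not_or] at hz'
    rw [mem_side] at hi
    rcases Finset.mem_insert.1 hz₀ with rfl | hz₀
    · have : i ∈ A := hmemA.2 (hsub z hz'.2 hadj' _ hi)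
      simp [σ', this]
    · have : i ∉ A := fun hiA => by
        have hzA : OnSide T.graph w w₀ z := OnSide.subset_of_inter
          (Or.inl (hwz z₀ hz₀ z hz hadj')) hi (hmemA.1 hiA) (OnSide.refl _ _ _)
        refine hconn w₀ hw₀ w hw hadj z₀ hz₀ (hzA.step hadj' fun he => ?_)
        rcases Sym2.eq_iff.1 he with ⟨h1, -⟩ | ⟨h1, -⟩
        · exact hz'.1 h1
        · exact hz'.2 (h1 ▸ hw₀)
      simp only [σ', this, if_false]
      exact hσside z₀ hz₀ z hz'.2 hadj' i ((mem_side T).2 hi)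
  · intro i hi
    rcases Finset.mem_insert.1 hi with hi | hi
    · have : i ∈ A := hmemA.2 (hi ▸ OnSide.refl _ _ _)
      simp [σ', this, hi]
    · have : i ∉ A := fun hiA => hconn w₀ hw₀ w hw hadj _ hi (hmemA.1 hiA)
      simp [σ', this, hσsite i hi]
  · intro r hr α
    rcases Finset.mem_insert.1 hr with rfl | hr
    · rw [hfib, hg'w]; exact hu.tame _
    · by_cases hr₀ : r = w₀
      · subst hr₀
        rw [hfib₀, hg'w₀]
        exact (hu.tame_coeff (hgt r hr α) hAσ _).const_mul _
      · rw [hfib' r hr hr₀, hg' r hr hr₀]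
        exact hgt r hr α
  · intro r hr α β hαβ
    have he₀ : ∀ v ∈ e₀.1, v ∈ insert w R := by
      intro v hv
      rcases Sym2.mem_iff.1 hv with rfl | rfl
      · simp
      · simp [hw₀]
    rcases Finset.mem_insert.1 hr with rfl | hr
    · rw [hg'w, hg'w, hαβ e₀ ⟨Sym2.mem_mk_left _ _, he₀⟩]
    · have hgr : g r α = g r β := hgd r hr fun e he =>
        hαβ e ⟨he.1, fun v hv => Finset.mem_insert_of_mem (he.2 v hv)⟩
      by_cases hr₀ : r = w₀
      · subst hr₀
        rw [hg'w₀, hg'w₀, hαβ e₀ ⟨Sym2.mem_mk_right _ _, he₀⟩]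
        simp only [c, hgr]
      · rw [hg' r hr hr₀, hg' r hr hr₀, hgr]
  · have hU : (Finset.univ.filter (σ · ∈ R) : Finset (Fin D)) = Finset.univ := by
      ext i; simp [hσR i]
    have hpt : ∀ α, Tame Finset.univ (fun x => ∏ r ∈ R, g r α x) := fun α => by
      rw [← hU]; exact Tame.prod_fiber σ R fun r hr => hgt r hr α
    have hF : Tame Finset.univ (fun x => ∑ α, ∏ r ∈ R, g r α x) := Tame.sum _ fun α _ => hpt α
    refine (hproj.symm.trans (hu.proj_congr_ae hf hF hfg)).trans
      (Filter.Eventually.of_forall fun x => ?_)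
    -- the index on the new edge does not occur in the old tensors
    have hupd : ∀ r ∈ R, ∀ α b, g r (Function.update α e₀ b) = g r α := by
      intro r hr α b
      refine hgd r hr fun e he => Function.update_of_ne ?_ _ _
      rintro rfl
      exact hw (he.2 w (Sym2.mem_mk_left _ _))
    have hterm : ∀ α, proj A u (fun x => ∏ r ∈ R, g r α x) x =
        ∑ b, (∏ r ∈ R.erase w₀, g r α x) * (u b x * c α b x) := by
      intro α
      have h1 : (fun x => ∏ r ∈ R, g r α x) =
          fun x => (∏ r ∈ R.erase w₀, g r α x) * g w₀ α x :=
        funext fun x => (Finset.prod_erase_mul R _ hw₀).symm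
      have h2 := Tame.prod_fiber σ (R.erase w₀) fun r hr => hgt r (Finset.mem_of_mem_erase hr) α
      rw [h1, proj_mul_left (h2.congr_off ?_), ← Finset.mul_sum]
      · rfl
      · rw [Finset.disjoint_left]
        intro i hi hiA
        have := Finset.ne_of_mem_erase (Finset.mem_filter.1 hi).2
        exact this (hσside w₀ hw₀ w hw hadj i hiA)
    rw [hu.proj_sum _ (fun α _ => hpt α) (Finset.subset_univ _)]
    simp_rw [hterm]
    rw [sum_sum_eq_card_mul_sum e₀ _ fun α b b' => ?_]
    · refine Finset.sum_congr rfl fun α _ => ?_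
      have hprod : ∏ r ∈ R.erase w₀, g' r α x = ∏ r ∈ R.erase w₀, g r α x :=
        Finset.prod_congr rfl fun r hr => by
          rw [hg' r (Finset.mem_of_mem_erase hr) (Finset.ne_of_mem_erase hr)]
      rw [Finset.prod_insert hw, hg'w, ← Finset.mul_prod_erase R _ hw₀, hg'w₀, Fintype.card_fin,
        hprod]
      ring
    · simp only [c, hupd w₀ hw₀]
      congr 1
      exact Finset.prod_congr rfl fun r hr => by rw [hupd r (Finset.mem_of_mem_erase hr)]

lemma PartialNetwork.univ [Fintype V] (hn : 1 ≤ n) (hf : Tame Finset.univ f)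
    (hrank : ∀ u v, T.graph.Adj u v → SepRank (T.side u v) n f) :
    PartialNetwork T n f Finset.univ := by
  have hconn := T.isTree.connected
  obtain ⟨o⟩ := hconn.nonempty
  have hgrow : ∀ k (R : Finset V), Rᶜ.card = k → PartialNetwork T n f R →
      PartialNetwork T n f Finset.univ := by
    intro k
    induction k with
    | zero =>
      intro R hk hR
      rw [Finset.card_eq_zero, Finset.compl_eq_empty_iff] at hk
      exact hk ▸ hR
    | succ k ih =>
      intro R hk hR
      obtain ⟨a, ha⟩ := hR.1
      obtain ⟨b, hb⟩ : Rᶜ.Nonempty := by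
        rw [← Finset.card_pos]; omega
      obtain ⟨p⟩ := hconn.preconnected a b
      obtain ⟨d, -, hd₁, hd₂⟩ := p.exists_boundary_dart (R : Set V) ha (by simpa using hb)
      have hw : d.snd ∉ R := hd₂
      refine ih (insert d.snd R) ?_
        (hR.grow hf hd₁ hw d.adj.symm (hrank _ _ d.adj.symm))
      rw [Finset.card_compl, Finset.card_insert_of_notMem hw] at *
      omega
  exact hgrow _ {o} rfl (PartialNetwork.singleton hn hf o)

/-- Extend values on a subtype by zero. -/
def extendZero {P : Fin D → Prop} [DecidablePred P] (y : {i // P i} → ℝ) (i : Fin D) : ℝ :=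
  if h : P i then y ⟨i, h⟩ else 0

lemma Tame.memLp_extendZero {P : Fin D → Prop} [DecidablePred P] {h : (Fin D → ℝ) → ℝ}
    (hh : Tame (Finset.univ.filter P) h) :
    MemLp (fun y : {i // P i} → ℝ => h (extendZero y)) 2 volume := by
  have hmeas : Measurable (fun y : {i // P i} → ℝ => h (extendZero y)) := by
    refine hh.measurable.comp (measurable_pi_lambda _ fun i => ?_)
    by_cases hi : P i
    · simpa [extendZero, hi] using measurable_pi_apply _
    · simp [extendZero, hi]
  obtain ⟨C, -, hC⟩ := hh.sq.bound
  rw [memLp_two_iff_integrable_sq hmeas.aestronglyMeasurable]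
  refine ((Tame.integrable_prod_weight {i // P i}).const_mul C).mono'
    (hmeas.pow_const 2).aestronglyMeasurable (Filter.Eventually.of_forall fun y => ?_)
  refine (hC _).trans_eq ?_
  rw [← Finset.prod_subtype_eq_prod_filter]
  congr 1
  refine Finset.prod_congr (by simp) fun i _ => ?_
  simp [extendZero, i.2]

end Exact

/-- A tame function of separation rank at most `n` across every inner edge is represented by a tree
tensor network whose bond dimensions all equal `n`. -/
lemma exists_functionalTTN {D : ℕ} {V : Type*} [Fintype V] [DecidableEq V] (T : TreeShape D V)
    {n : ℕ} (hn : 1 ≤ n) {f : (Fin D → ℝ) → ℝ} (hf : Tame Finset.univ f)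
    (hrank : ∀ u v, T.graph.Adj u v → SepRank (T.side u v) n f) :
    ∃ N : FunctionalTTN T, (∀ e, N.bondDim e = n) ∧ f =ᵐ[volume] N.eval := by
  classical
  obtain ⟨-, -, σ, -, -, hσ, g, hgt, hgd, hfg⟩ := PartialNetwork.univ (T := T) hn hf hrank
  have hσ' : σ = T.site := funext fun i => hσ i (Finset.mem_univ _)
  subst hσ'
  let ext : (v : V) → (T.EdgeAt v → Fin n) → T.Edge → Fin n := fun v a e =>
    if h : v ∈ e.1 then a ⟨e, h⟩ else ⟨0, hn⟩
  refine ⟨⟨fun _ => n, fun v a y => g v (ext v a) (extendZero y), fun v a => ?_⟩,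
    fun _ => rfl, hfg.trans (Filter.Eventually.of_forall fun x => ?_)⟩
  · exact (hgt v (Finset.mem_univ _) _).memLp_extendZero
  · unfold FunctionalTTN.eval
    simp only
    refine Finset.sum_congr (by congr) fun α _ => Finset.prod_congr rfl fun v hv => ?_
    rw [hgd v hv (y := ext v fun e => α e.1) fun e he => by simp [ext, he.1]]
    refine (hgt v hv _).dependsOn fun i hi => ?_
    have hi : T.site i = v := by simpa using hi
    simp [extendZero, hi]

/-! ### Approximation by a tree tensor network from bipartite approximations -/

/-- Approximations of rank `n` across each single inner edge yield a tree tensor network of bond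
dimension `n`. Only distinct nonempty bipartitions count for the error, so the bound does not
involve the number of vertices. -/
lemma exists_functionalTTN_of_bipartite {D : ℕ} {V : Type*} [Fintype V] [DecidableEq V]
    (T : TreeShape D V) {n : ℕ} (hn : 1 ≤ n) {f : (Fin D → ℝ) → ℝ} (hf : Tame Finset.univ f)
    {δ : ENNReal} (happ : ∀ u v, T.graph.Adj u v →
      ∃ g, SepRank (T.side u v) n g ∧ eLpNorm (fun x => f x - g x) 2 volume ≤ δ) :
    ∃ N : FunctionalTTN T, (∀ e, N.bondDim e = n) ∧
      eLpNorm (fun x => f x - N.eval x) 2 volume ≤ 2 * (D * D : ℕ) * δ := by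
  classical
  obtain ⟨o⟩ := T.isTree.connected.nonempty
  set 𝒜 : Finset (Finset (Fin D)) := Finset.univ.filter fun A =>
    A.Nonempty ∧ ∃ u v, T.graph.Adj u v ∧ ¬ OnSide T.graph u v o ∧ A = T.side u v with h𝒜
  have hlam : ∀ A ∈ 𝒜, ∀ B ∈ 𝒜, A ⊆ B ∨ B ⊆ A ∨ Disjoint A B := by
    intro A hA B hB
    obtain ⟨-, u, v, huv, ho, rfl⟩ := (Finset.mem_filter.1 hA).2
    obtain ⟨-, p, q, hpq, ho', rfl⟩ := (Finset.mem_filter.1 hB).2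
    rcases onSide_laminar T.isTree huv ho ho' with h | h | h
    · exact Or.inl fun i hi => (mem_side T).2 (h _ ((mem_side T).1 hi))
    · exact Or.inr (Or.inl fun i hi => (mem_side T).2 (h _ ((mem_side T).1 hi)))
    · exact Or.inr (Or.inr (Finset.disjoint_left.2 fun i hi hi' =>
        h _ ((mem_side T).1 hi) ((mem_side T).1 hi')))
  have hcard : 𝒜.card ≤ D * D :=
    card_le_of_laminar 𝒜 hlam fun A hA => (Finset.mem_filter.1 hA).2.1
  obtain ⟨g, hg, hgr, hgd⟩ := exists_sepRank_of_laminar hf 𝒜 hlam fun A hA => by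
    obtain ⟨-, u, v, huv, -, rfl⟩ := (Finset.mem_filter.1 hA).2
    exact happ u v huv
  have hroot : ∀ u v, T.graph.Adj u v → ¬ OnSide T.graph u v o → SepRank (T.side u v) n g := by
    intro u v huv ho
    rcases (T.side u v).eq_empty_or_nonempty with he | he
    · rw [he]; exact SepRank.empty hn hg
    · exact hgr _ (Finset.mem_filter.2 ⟨Finset.mem_univ _, he, u, v, huv, ho, rfl⟩)
  obtain ⟨N, hN, hgN⟩ := exists_functionalTTN T hn hg fun u v huv => by
    by_cases ho : OnSide T.graph u v o
    · have h := (hroot v u huv.symm (ho.not_symm T.isTree.isAcyclic huv)).compl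
      rwa [side_compl T huv, compl_compl] at h
    · exact hroot u v huv ho
  refine ⟨N, hN, ?_⟩
  have e : (fun x => f x - N.eval x) =ᵐ[volume] fun x => f x - g x := by
    filter_upwards [hgN] with x hx
    rw [hx]
  rw [eLpNorm_congr_ae e]
  refine hgd.trans ?_
  gcongr

/-! ### Taylor truncation of the coupling of one canonical pair -/

/-- The Taylor polynomial of the exponential with `N` terms. -/
noncomputable def expTaylor (N : ℕ) (t : ℝ) : ℝ := ∑ n : Fin N, t ^ (n : ℕ) / (n : ℕ).factorial

lemma measurable_expTaylor (N : ℕ) : Measurable (expTaylor N) := by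
  unfold expTaylor
  fun_prop

/-- Each remainder term with `n ≥ N` gains `θ ^ N` when the argument is enlarged by `1 / θ`. -/
lemma abs_expTaylor_sub_exp_le (N : ℕ) (t : ℝ) {θ : ℝ} (h0 : 0 < θ) (h1 : θ ≤ 1) :
    |expTaylor N t - Real.exp t| ≤ θ ^ N * Real.exp (|t| / θ) := by
  have hs : ∀ y : ℝ, HasSum (fun n : ℕ => y ^ n / n.factorial) (Real.exp y) := fun y => by
    rw [Real.exp_eq_exp_ℝ]
    exact NormedSpace.expSeries_div_hasSum_exp y
  have htail : ∀ y : ℝ, HasSum (fun n : ℕ => y ^ (n + N) / (n + N).factorial)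
      (Real.exp y - expTaylor N y) := fun y => by
    have h := (hasSum_nat_add_iff' N).2 (hs y)
    rwa [Finset.sum_range] at h
  have hpos : 0 ≤ expTaylor N (|t| / θ) := Finset.sum_nonneg fun n _ => by positivity
  rw [abs_sub_comm, ← (htail t).tsum_eq, ← Real.norm_eq_abs]
  refine (tsum_of_norm_bounded (f := fun n : ℕ => t ^ (n + N) / ((n + N).factorial : ℝ))
    ((htail (|t| / θ)).mul_left (θ ^ N)) fun n => ?_).trans ?_
  · rw [Real.norm_eq_abs, abs_div, abs_pow, Nat.abs_cast, ← mul_div_assoc]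
    gcongr
    rw [div_pow, pow_add θ, ← mul_div_assoc, le_div_iff₀ (by positivity)]
    calc |t| ^ (n + N) * (θ ^ n * θ ^ N) = θ ^ N * |t| ^ (n + N) * θ ^ n := by ring
      _ ≤ θ ^ N * |t| ^ (n + N) * 1 := by
        gcongr
        exact pow_le_one₀ h0.le h1
      _ = _ := mul_one _
  · gcongr
    linarith

/-- The relative error factor of the truncation of `exp t`. -/
noncomputable def truncFactor (N : ℕ) (t : ℝ) : ℝ := Real.exp (-t) * expTaylor N t

lemma measurable_truncFactor (N : ℕ) : Measurable (truncFactor N) :=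
  (Real.measurable_exp.comp measurable_neg).mul (measurable_expTaylor N)

lemma sq_truncFactor_sub_one_le (N : ℕ) (t : ℝ) {θ : ℝ} (h0 : 0 < θ) (h1 : θ ≤ 1) :
    (truncFactor N t - 1) ^ 2 ≤ (θ ^ N) ^ 2 * Real.exp (2 * (|t| / θ - t)) := by
  have h : truncFactor N t - 1 = Real.exp (-t) * (expTaylor N t - Real.exp t) := by
    rw [truncFactor, mul_sub, ← Real.exp_add]
    simp
  rw [h, mul_pow, ← sq_abs (_ - _)]
  calc Real.exp (-t) ^ 2 * |expTaylor N t - Real.exp t| ^ 2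
      ≤ Real.exp (-t) ^ 2 * (θ ^ N * Real.exp (|t| / θ)) ^ 2 := by
        gcongr
        exact abs_expTaylor_sub_exp_le N t h0 h1
    _ = (θ ^ N) ^ 2 * (Real.exp (-t) * Real.exp (|t| / θ)) ^ 2 := by ring
    _ = _ := by
        rw [← Real.exp_add, ← Real.exp_nat_mul]
        congr 2
        push_cast
        ring

lemma lintegral_exp_neg_mul_sq {b : ℝ} (hb : 0 < b) :
    ∫⁻ x : ℝ, ENNReal.ofReal (Real.exp (-b * x ^ 2)) = ENNReal.ofReal √(Real.pi / b) := by
  rw [← integral_gaussian, ofReal_integral_eq_lintegral_ofReal (integrable_exp_neg_mul_sq hb)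
    (Filter.Eventually.of_forall fun _ => (Real.exp_pos _).le)]

open ProbabilityTheory in
/-- With `x = w + z` and `t = x z / (2 (1 - s))` the coupling of a canonical pair of correlation
`√s`, the exponents of the two Gaussian densities and of `exp (-2 t)` add up to a multiple of
`-(x² + z² / s)`, which dominates `2 |t| / θ` as soon as `√s ≤ θ²`. -/
lemma lintegral_exp_coupling_le {s : NNReal} {θ : ℝ} (hs0 : 0 < s) (hs1 : s < 1) (h0 : 0 < θ)
    (h1 : θ < 1) (hs : √(s : ℝ) ≤ θ ^ 2) :
    ∫⁻ z, ∫⁻ w, ENNReal.ofReal (Real.exp (2 * (|(w + z) * z / (2 * (1 - s))| / θ -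
      (w + z) * z / (2 * (1 - s))))) ∂gaussianReal 0 (1 - s) ∂gaussianReal 0 s ≤
      ENNReal.ofReal (1 / (1 - θ)) := by
  have hs0' : (0 : ℝ) < s := hs0
  have hs1' : (s : ℝ) < 1 := hs1
  have hcoe : ((1 - s : NNReal) : ℝ) = 1 - s := by rw [NNReal.coe_sub hs1.le, NNReal.coe_one]
  have hd : (0 : ℝ) < 1 - s := by linarith
  have hv : (1 - s : NNReal) ≠ 0 := (tsub_pos_of_lt hs1).ne'
  set b : ℝ := (1 - θ) / (2 * (1 - s)) with hb
  have hb0 : 0 < b := by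
    have : 0 < 1 - θ := by linarith
    positivity
  set k : ℝ := (√(2 * Real.pi * s))⁻¹ * (√(2 * Real.pi * (1 - s)))⁻¹ with hk
  have hk0 : 0 ≤ k := by positivity
  have hkey : ∀ w z : ℝ, gaussianPDFReal 0 s z * (gaussianPDFReal 0 (1 - s) w *
      Real.exp (2 * (|(w + z) * z / (2 * (1 - s))| / θ - (w + z) * z / (2 * (1 - s))))) ≤
      k * Real.exp (-(b / s) * z ^ 2) * Real.exp (-b * (w + z) ^ 2) := by
    intro w z
    unfold gaussianPDFReal
    rw [hcoe]
    have e1 : ∀ c d E F G : ℝ, c * Real.exp E * (d * Real.exp F * Real.exp G) =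
        c * d * Real.exp (E + F + G) := fun c d E F G => by
      rw [Real.exp_add, Real.exp_add]; ring
    rw [e1, mul_assoc k, ← Real.exp_add]
    refine mul_le_mul_of_nonneg_left (Real.exp_le_exp.2 ?_) hk0
    set x := w + z with hx
    have hw : w = x - z := by rw [hx]; ring
    have hsq : √(s : ℝ) * √(s : ℝ) = s := Real.mul_self_sqrt hs0'.le
    have hr : 0 < √(s : ℝ) := Real.sqrt_pos.2 hs0'
    -- `|x z| ≤ √s (x² + z² / s) / 2` and `√s / θ ≤ θ`
    have habs : |x * z| / θ ≤ θ * (x ^ 2 + z ^ 2 / s) / 2 := by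
      have h2 : |x * z| ≤ √(s : ℝ) * (x ^ 2 + z ^ 2 / s) / 2 := by
        have h3 : √(s : ℝ) * (x ^ 2 + z ^ 2 / s) / 2 =
            (s * x ^ 2 + z ^ 2) / (2 * √(s : ℝ)) := by
          rw [div_eq_div_iff (by positivity) (by positivity)]
          field_simp
          rw [Real.sq_sqrt hs0'.le]
        rw [h3, le_div_iff₀ (by positivity), abs_mul]
        have h4 := sq_nonneg (√(s : ℝ) * |x| - |z|)
        nlinarith [sq_abs x, sq_abs z]
      rw [div_le_iff₀ h0]
      refine h2.trans ?_
      have h5 : 0 ≤ x ^ 2 + z ^ 2 / s := by positivity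
      nlinarith
    have h6 : |x * z / (2 * (1 - s))| = |x * z| / (2 * (1 - s)) := by
      rw [abs_div, abs_of_pos (by positivity : (0 : ℝ) < 2 * (1 - s))]
    have h7 : -(z - 0) ^ 2 / (2 * (s : ℝ)) + -(w - 0) ^ 2 / (2 * (1 - s)) +
        2 * (|x * z / (2 * (1 - s))| / θ - x * z / (2 * (1 - s))) =
        (|x * z| / θ - (x ^ 2 + z ^ 2 / s) / 2) / (1 - s) := by
      rw [h6, hw]
      field_simp
      ring
    have h8 : -(b / s) * z ^ 2 + -b * x ^ 2 =
        (θ * (x ^ 2 + z ^ 2 / s) / 2 - (x ^ 2 + z ^ 2 / s) / 2) / (1 - s) := by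
      rw [hb]
      field_simp
      ring
    rw [h7, h8]
    gcongr
  have hmeas : Measurable fun p : ℝ × ℝ => ENNReal.ofReal (Real.exp (2 *
      (|(p.2 + p.1) * p.1 / (2 * (1 - s))| / θ - (p.2 + p.1) * p.1 / (2 * (1 - s))))) := by
    fun_prop
  have hmeas' : ∀ z : ℝ, Measurable fun w : ℝ => ENNReal.ofReal (Real.exp (2 *
      (|(w + z) * z / (2 * (1 - s))| / θ - (w + z) * z / (2 * (1 - s))))) := fun z => by
    fun_prop
  rw [gaussianReal_of_var_ne_zero _ hs0.ne', gaussianReal_of_var_ne_zero _ hv,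
    lintegral_withDensity_eq_lintegral_mul _ (measurable_gaussianPDF _ _)]
  swap
  · exact Measurable.lintegral_prod_right hmeas
  calc _ ≤ ∫⁻ z : ℝ, ENNReal.ofReal (k * Real.exp (-(b / s) * z ^ 2)) *
        ∫⁻ w : ℝ, ENNReal.ofReal (Real.exp (-b * (w + z) ^ 2)) := by
        refine lintegral_mono fun z => ?_
        rw [Pi.mul_apply, lintegral_withDensity_eq_lintegral_mul _ (measurable_gaussianPDF _ _)
          (hmeas' z), ← lintegral_const_mul, ← lintegral_const_mul]
        · refine lintegral_mono fun w => ?_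
          simp only [Pi.mul_apply, gaussianPDF]
          rw [← ENNReal.ofReal_mul (gaussianPDFReal_nonneg _ _ _),
            ← ENNReal.ofReal_mul (gaussianPDFReal_nonneg _ _ _),
            ← ENNReal.ofReal_mul (by positivity)]
          exact ENNReal.ofReal_le_ofReal (hkey w z)
        · fun_prop
        · exact (measurable_gaussianPDF _ _).mul (hmeas' z)
    _ = ∫⁻ z : ℝ, ENNReal.ofReal (k * √(Real.pi / b)) *
          ENNReal.ofReal (Real.exp (-(b / s) * z ^ 2)) := by
        refine lintegral_congr fun z => ?_
        rw [lintegral_add_right_eq_self (fun w => ENNReal.ofReal (Real.exp (-b * w ^ 2))) z,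
          lintegral_exp_neg_mul_sq hb0, ← ENNReal.ofReal_mul (by positivity),
          ← ENNReal.ofReal_mul (by positivity), mul_right_comm]
    _ = ENNReal.ofReal (k * √(Real.pi / b) * √(Real.pi / (b / s))) := by
        rw [lintegral_const_mul _ (by fun_prop), lintegral_exp_neg_mul_sq (by positivity),
          ← ENNReal.ofReal_mul (by positivity)]
    _ ≤ _ := by
        refine ENNReal.ofReal_le_ofReal ?_
        have e : k * √(Real.pi / b) * √(Real.pi / (b / s)) = √(1 - s) / (1 - θ) := by
          have h1θ : 0 < 1 - θ := by linarith
          rw [hk, ← mul_inv, ← Real.sqrt_mul (by positivity), mul_assoc,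
            ← Real.sqrt_mul (by positivity), ← Real.sqrt_inv, ← Real.sqrt_mul (by positivity)]
          rw [Real.sqrt_eq_iff_mul_self_eq (by positivity) (by positivity),
            div_mul_div_comm √(1 - (s : ℝ)),
            Real.mul_self_sqrt hd.le, hb]
          field_simp
        rw [e]
        gcongr
        exact Real.sqrt_le_one.2 (by linarith)

/-! ### Products of independent factors close to one -/

open ProbabilityTheory in
/-- Independence makes norms of products multiplicative, so the errors of independent factors
multiply as if they were deterministic. -/
lemma eLpNorm_prod_sub_one_add_one_le {Ω κ : Type*} [MeasurableSpace Ω] {μ : Measure Ω}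
    [IsProbabilityMeasure μ] {Y : κ → Ω → ℝ} (hY : iIndepFun Y μ) (hm : ∀ k, Measurable (Y k))
    {δ : ENNReal} (hδ : ∀ k, eLpNorm (fun z => Y k z - 1) 2 μ ≤ δ) (s : Finset κ) :
    eLpNorm (fun z => ∏ k ∈ s, Y k z - 1) 2 μ + 1 ≤ (1 + δ) ^ s.card := by
  classical
  have hone : eLpNorm (fun _ : Ω => (1 : ℝ)) 2 μ = 1 := by
    rw [eLpNorm_two_eq]
    simp
  induction s using Finset.induction_on with
  | empty => simp
  | insert a s ha ih =>
    have hP : Measurable fun z => ∏ k ∈ s, Y k z := Finset.measurable_prod _ fun k _ => hm k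
    have hYa : eLpNorm (Y a) 2 μ ≤ 1 + δ := by
      have e : Y a = (fun _ => (1 : ℝ)) + fun z => Y a z - 1 := by ext; simp
      rw [e]
      refine (eLpNorm_add_le aestronglyMeasurable_const
        ((hm a).sub_const 1).aestronglyMeasurable one_le_two).trans ?_
      rw [hone]
      exact add_le_add le_rfl (hδ a)
    have hind : IndepFun (Y a) (∏ k ∈ s, Y k) μ :=
      (hY.indepFun_finsetProd_of_notMem hm ha).symm
    have hmul : eLpNorm (fun z => Y a z * (∏ k ∈ s, Y k z - 1)) 2 μ =
        eLpNorm (Y a) 2 μ * eLpNorm (fun z => ∏ k ∈ s, Y k z - 1) 2 μ := by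
      have h1 : IndepFun (fun z => ENNReal.ofReal (Y a z ^ 2))
          (fun z => ENNReal.ofReal ((∏ k ∈ s, Y k z - 1) ^ 2)) μ := by
        have := hind.comp (φ := fun t : ℝ => ENNReal.ofReal (t ^ 2))
          (ψ := fun t : ℝ => ENNReal.ofReal ((t - 1) ^ 2)) (by fun_prop) (by fun_prop)
        simpa [Function.comp_def, Finset.prod_apply] using this
      rw [eLpNorm_two_eq, eLpNorm_two_eq, eLpNorm_two_eq,
        ← ENNReal.mul_rpow_of_nonneg _ _ (by norm_num),
        ← lintegral_mul_eq_lintegral_mul_lintegral_of_indepFun ((hm a).pow_const 2).ennreal_ofReal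
          ((hP.sub_const 1).pow_const 2).ennreal_ofReal h1]
      congr 1
      refine lintegral_congr fun z => ?_
      rw [Pi.mul_apply, mul_pow, ENNReal.ofReal_mul (sq_nonneg _)]
    have e : (fun z => ∏ k ∈ insert a s, Y k z - 1) =
        (fun z => Y a z * (∏ k ∈ s, Y k z - 1)) + fun z => Y a z - 1 := by
      ext z
      rw [Finset.prod_insert ha, Pi.add_apply]
      ring
    rw [e, Finset.card_insert_of_notMem ha, pow_succ']
    calc _ ≤ eLpNorm (Y a) 2 μ * eLpNorm (fun z => ∏ k ∈ s, Y k z - 1) 2 μ + δ + 1 := by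
          gcongr
          refine (eLpNorm_add_le (f := fun z => Y a z * (∏ k ∈ s, Y k z - 1))
            ((hm a).mul (hP.sub_const 1)).aestronglyMeasurable
            ((hm a).sub_const 1).aestronglyMeasurable one_le_two).trans ?_
          rw [hmul]
          exact add_le_add le_rfl (hδ a)
      _ ≤ (1 + δ) * eLpNorm (fun z => ∏ k ∈ s, Y k z - 1) 2 μ + δ + 1 := by gcongr
      _ = (1 + δ) * (eLpNorm (fun z => ∏ k ∈ s, Y k z - 1) 2 μ + 1) := by ring
      _ ≤ _ := by gcongr

/-! ### Linear functionals of a standard Gaussian vector -/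

section StdGaussian

open ProbabilityTheory Matrix

variable {ι κ : Type*} [Fintype ι] [Fintype κ]

/-- The law of a vector of independent standard normal variables. -/
noncomputable def stdNormal (ι : Type*) [Fintype ι] : Measure (ι → ℝ) :=
  Measure.pi fun _ => gaussianReal 0 1

instance : IsProbabilityMeasure (stdNormal ι) := by unfold stdNormal; infer_instance

lemma hasGaussianLaw_stdNormal : HasGaussianLaw (fun z : ι → ℝ => z) (stdNormal ι) := by
  have h1 : ∀ i : ι, HasGaussianLaw (fun z : ι → ℝ => z i) (stdNormal ι) := fun i => by
    refine ⟨?_⟩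
    rw [stdNormal, (measurePreserving_eval (fun _ : ι => gaussianReal 0 1) i).map_eq]
    infer_instance
  exact iIndepFun.hasGaussianLaw (X := fun (i : ι) (z : ι → ℝ) => z i) h1
    (iIndepFun_pi (X := fun _ : ι => (id : ℝ → ℝ)) fun _ => aemeasurable_id)

lemma covariance_eval_stdNormal [DecidableEq ι] (i j : ι) :
    cov[fun z => z i, fun z => z j; stdNormal ι] = if i = j then 1 else 0 := by
  have hi : ∀ i : ι, MemLp (fun z : ι → ℝ => z i) 2 (stdNormal ι) := fun i =>
    (hasGaussianLaw_stdNormal.eval i).memLp_two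
  split_ifs with h
  · subst h
    rw [covariance_self (hi i).aemeasurable]
    have := variance_id_gaussianReal (μ := 0) (v := 1)
    rw [← (measurePreserving_eval (fun _ : ι => gaussianReal 0 1) i).map_eq,
      variance_map aemeasurable_id (measurable_pi_apply i).aemeasurable] at this
    have h : Var[fun z => z i; stdNormal ι] = ((1 : NNReal) : ℝ) := this
    simpa using h
  · exact (iIndepFun_pi (X := fun _ : ι => (id : ℝ → ℝ)) fun _ => aemeasurable_id).indepFun h
      |>.covariance_eq_zero (hi i) (hi j)

lemma covariance_dotProduct_stdNormal (c d : ι → ℝ) :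
    cov[fun z => c ⬝ᵥ z, fun z => d ⬝ᵥ z; stdNormal ι] = c ⬝ᵥ d := by
  classical
  have hi : ∀ i : ι, MemLp (fun z : ι → ℝ => z i) 2 (stdNormal ι) := fun i =>
    (hasGaussianLaw_stdNormal.eval i).memLp_two
  simp only [dotProduct]
  rw [covariance_fun_sum_fun_sum (fun i => (hi i).const_mul _) (fun i => (hi i).const_mul _)]
  simp_rw [covariance_const_mul_left, covariance_const_mul_right, covariance_eval_stdNormal]
  simp

lemma hasGaussianLaw_linear {E : Type*} [NormedAddCommGroup E] [NormedSpace ℝ E]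
    [MeasurableSpace E] [BorelSpace E] (L : (ι → ℝ) →ₗ[ℝ] E) :
    HasGaussianLaw (fun z => L z) (stdNormal ι) :=
  hasGaussianLaw_stdNormal.map_fun (LinearMap.toContinuousLinearMap L)

lemma map_dotProduct_stdNormal (c : ι → ℝ) :
    (stdNormal ι).map (fun z => c ⬝ᵥ z) = gaussianReal 0 (c ⬝ᵥ c).toNNReal := by
  have h : HasGaussianLaw (fun z => c ⬝ᵥ z) (stdNormal ι) :=
    hasGaussianLaw_linear (dotProductBilin ℝ ℝ c)
  rw [h.map_eq_gaussianReal]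
  have hm : (stdNormal ι)[fun z => c ⬝ᵥ z] = 0 := by
    simp only [dotProduct]
    rw [integral_finsetSum _ fun i _ =>
      ((hasGaussianLaw_stdNormal.eval i).integrable).const_mul (c i)]
    refine Finset.sum_eq_zero fun i _ => ?_
    rw [integral_const_mul]
    have h0 := integral_id_gaussianReal (μ := 0) (v := 1)
    rw [← (measurePreserving_eval (fun _ : ι => gaussianReal 0 1) i).map_eq] at h0
    have h : ∫ z, z i ∂stdNormal ι = 0 := by
      rw [← integral_map (μ := stdNormal ι) (φ := fun z : ι → ℝ => z i) (f := fun x : ℝ => x)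
        (measurable_pi_apply i).aemeasurable measurable_id.aestronglyMeasurable]
      exact h0
    rw [h, mul_zero]
  rw [hm, ← covariance_dotProduct_stdNormal c c, covariance_self]
  exact h.aemeasurable

/-- Families of linear functionals with vanishing cross covariances are independent. -/
lemma iIndepFun_dotProduct_stdNormal {β : Type*} [Fintype β] (c : κ → β → ι → ℝ)
    (h : ∀ k k', k ≠ k' → ∀ a b, c k a ⬝ᵥ c k' b = 0) :
    iIndepFun (fun k z a => c k a ⬝ᵥ z) (stdNormal ι) := by
  have hG : HasGaussianLaw (fun z k a => c k a ⬝ᵥ z) (stdNormal ι) :=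
    hasGaussianLaw_linear (LinearMap.pi fun k => LinearMap.pi fun a =>
      dotProductBilin ℝ ℝ (c k a))
  exact HasGaussianLaw.iIndepFun_of_covariance_eval (X := fun k a z => c k a ⬝ᵥ z) hG
    fun k k' hk a b => by rw [covariance_dotProduct_stdNormal]; exact h k k' hk a b

lemma indepFun_dotProduct_stdNormal (c d : ι → ℝ) (h : c ⬝ᵥ d = 0) :
    IndepFun (fun z => c ⬝ᵥ z) (fun z => d ⬝ᵥ z) (stdNormal ι) := by
  have hG : HasGaussianLaw (fun z => (c ⬝ᵥ z, d ⬝ᵥ z)) (stdNormal ι) :=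
    hasGaussianLaw_linear ((dotProductBilin ℝ ℝ c).prod (dotProductBilin ℝ ℝ d))
  exact hG.indepFun_of_covariance_eq_zero (by rw [covariance_dotProduct_stdNormal]; exact h)

lemma stdNormal_eq_withDensity :
    stdNormal ι = volume.withDensity fun z : ι → ℝ =>
      ENNReal.ofReal (∏ i, gaussianPDFReal 0 1 (z i)) := by
  unfold stdNormal
  refine Measure.pi_eq fun s hs => ?_
  rw [withDensity_apply _ (MeasurableSet.univ_pi hs), volume_pi, Measure.restrict_pi_pi]
  have hint : ∀ i, Integrable (gaussianPDFReal 0 1) (volume.restrict (s i)) := fun i =>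
    (integrable_gaussianPDFReal 0 1).restrict
  rw [← ofReal_integral_eq_lintegral_ofReal (Integrable.fintype_prod hint)
    (Filter.Eventually.of_forall fun z =>
      Finset.prod_nonneg fun i _ => gaussianPDFReal_nonneg _ _ _),
    integral_fintype_prod_eq_prod (fun _ => gaussianPDFReal 0 1),
    ENNReal.ofReal_prod_of_nonneg fun i _ => integral_nonneg fun x => gaussianPDFReal_nonneg _ _ _]
  refine Finset.prod_congr rfl fun i _ => ?_
  rw [gaussianReal_apply_eq_integral _ one_ne_zero]

lemma prod_gaussianPDFReal (z : ι → ℝ) :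
    ∏ i, gaussianPDFReal 0 1 (z i) =
      (√((2 * Real.pi) ^ Fintype.card ι))⁻¹ * Real.exp (-(1 / 2) * (z ⬝ᵥ z)) := by
  simp only [gaussianPDFReal, Finset.prod_mul_distrib, ← Real.exp_sum]
  congr 1
  · have h : √((2 * Real.pi) ^ Fintype.card ι) = √(2 * Real.pi) ^ Fintype.card ι := by
      rw [Real.sqrt_eq_iff_mul_self_eq (by positivity) (by positivity), ← mul_pow,
        Real.mul_self_sqrt Real.two_pi_pos.le]
    simp [h, -Nat.ofNat_pos, -Real.sqrt_mul]
  · congr 1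
    rw [dotProduct, Finset.mul_sum]
    refine Finset.sum_congr rfl fun i _ => ?_
    simp
    ring

/-- The density of covariance `M * Mᵀ` is that of the image of a standard normal vector
under `M`. -/
lemma lintegral_gaussianDensity_mul {D : ℕ} (M : Matrix (Fin D) (Fin D) ℝ) (hM : M.det ≠ 0)
    {F : (Fin D → ℝ) → ENNReal} (hF : Measurable F) :
    ∫⁻ x, ENNReal.ofReal (gaussianDensity (M * Mᵀ) x) * F x =
      ∫⁻ z, F (M *ᵥ z) ∂stdNormal (Fin D) := by
  have hdens : ∀ z, gaussianDensity (M * Mᵀ) (M *ᵥ z) =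
      |M.det|⁻¹ * ∏ i, gaussianPDFReal 0 1 (z i) := by
    intro z
    have hu : IsUnit M.det := hM.isUnit
    have hu' : IsUnit Mᵀ.det := by rwa [det_transpose]
    have h1 : (M *ᵥ z) ⬝ᵥ (M * Mᵀ)⁻¹ *ᵥ (M *ᵥ z) = z ⬝ᵥ z := by
      rw [Matrix.mul_inv_rev, mulVec_mulVec, Matrix.mul_assoc, Matrix.nonsing_inv_mul M hu,
        Matrix.mul_one, dotProduct_mulVec, vecMul_mulVec,
        Matrix.mul_nonsing_inv _ hu', vecMul_one]
    have h2 : √((2 * Real.pi) ^ D * (M * Mᵀ).det) = √((2 * Real.pi) ^ D) * |M.det| := by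
      rw [det_mul, det_transpose, Real.sqrt_mul (by positivity), Real.sqrt_mul_self_eq_abs]
    rw [gaussianDensity, h1, h2, prod_gaussianPDFReal, Fintype.card_fin, one_div, mul_inv]
    ring
  have hmeas : Measurable fun x : Fin D → ℝ => gaussianDensity (M * Mᵀ) x := by
    unfold gaussianDensity
    fun_prop
  have hmap := Real.map_matrix_volume_pi_eq_smul_volume_pi hM
  have hL : Measurable (fun z => M *ᵥ z) :=
    (LinearMap.continuous_of_finiteDimensional (Matrix.toLin' M)).measurable
  have hPDF : Measurable fun z : Fin D → ℝ => ∏ i, gaussianPDFReal 0 1 (z i) :=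
    Finset.measurable_prod _ fun i _ => (measurable_gaussianPDFReal 0 1).comp (measurable_pi_apply i)
  have h3 : ∫⁻ z, ENNReal.ofReal (gaussianDensity (M * Mᵀ) (M *ᵥ z)) * F (M *ᵥ z) =
      ENNReal.ofReal |M.det⁻¹| *
        ∫⁻ x, ENNReal.ofReal (gaussianDensity (M * Mᵀ) x) * F x := by
    rw [← smul_eq_mul (ENNReal.ofReal |M.det⁻¹|), ← lintegral_smul_measure, ← hmap,
      lintegral_map (f := fun x => ENNReal.ofReal (gaussianDensity (M * Mᵀ) x) * F x)
        (g := toLin' M) (hmeas.ennreal_ofReal.mul hF) hL]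
    simp only [toLin'_apply]
  have hd : ENNReal.ofReal |M.det⁻¹| ≠ 0 := by simpa using hM
  have hFM : Measurable fun z => F (M *ᵥ z) := hF.comp hL
  have h4 : ∫⁻ z, ENNReal.ofReal (gaussianDensity (M * Mᵀ) (M *ᵥ z)) * F (M *ᵥ z) =
      ENNReal.ofReal |M.det⁻¹| *
        ∫⁻ z, ENNReal.ofReal (∏ i, gaussianPDFReal 0 1 (z i)) * F (M *ᵥ z) := by
    rw [← lintegral_const_mul' _ _ ENNReal.ofReal_ne_top]
    refine lintegral_congr fun z => ?_
    rw [hdens, ENNReal.ofReal_mul (by positivity), abs_inv, mul_assoc]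
  have h5 : ∫⁻ z, F (M *ᵥ z) ∂stdNormal (Fin D) =
      ∫⁻ z, ENNReal.ofReal (∏ i, gaussianPDFReal 0 1 (z i)) * F (M *ᵥ z) := by
    rw [stdNormal_eq_withDensity]
    exact lintegral_withDensity_eq_lintegral_mul _ hPDF.ennreal_ofReal hFM
  rw [h5]
  exact (ENNReal.mul_right_inj hd ENNReal.ofReal_ne_top).1 (h3.symm.trans h4)

end StdGaussian

/-! ### Canonical correlation analysis of a bipartition -/

section Matrices

open Matrix

variable {m n : Type*} [Fintype m] [DecidableEq m] [Fintype n] [DecidableEq n]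

/-- A positive definite covariance is the covariance of a linear image of a standard vector. -/
lemma exists_mul_transpose_eq {S : Matrix m m ℝ} (hS : S.PosDef) :
    ∃ M : Matrix m m ℝ, M.det ≠ 0 ∧ S = M * Mᵀ := by
  set U : Matrix m m ℝ := hS.1.eigenvectorUnitary.1 with hU
  set d := hS.1.eigenvalues with hd
  have hspec : S = U * diagonal d * Uᵀ := by
    have := hS.1.spectral_theorem
    rw [Unitary.conjStarAlgAut_apply] at this
    simpa [Matrix.star_eq_conjTranspose] using this
  have hdiag : diagonal d = diagonal (fun i => √(d i)) * (diagonal fun i => √(d i))ᵀ := by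
    rw [diagonal_transpose, diagonal_mul_diagonal]
    congr 1
    ext i
    exact (Real.mul_self_sqrt (hS.eigenvalues_pos i).le).symm
  have hSM : S = (U * diagonal fun i => √(d i)) * (U * diagonal fun i => √(d i))ᵀ := by
    rw [transpose_mul, hspec, hdiag]
    simp only [Matrix.mul_assoc]
  refine ⟨_, fun h => ?_, hSM⟩
  have h0 := hS.det_pos
  rw [hSM, det_mul, h, zero_mul] at h0
  exact h0.false

/-- A positive definite and a symmetric form are diagonalized simultaneously. -/
lemma exists_simultaneous_diagonalization {S K : Matrix m m ℝ} (hS : S.PosDef) (hK : Kᵀ = K) :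
    ∃ (W : Matrix m m ℝ) (s : m → ℝ), W * S * Wᵀ = 1 ∧ W * K * Wᵀ = diagonal s := by
  obtain ⟨M, hM, rfl⟩ := exists_mul_transpose_eq hS
  have hu : IsUnit M.det := hM.isUnit
  have hu' : IsUnit Mᵀ.det := by rwa [det_transpose]
  have hH : (M⁻¹ * K * M⁻¹ᵀ).IsHermitian := by
    rw [Matrix.IsHermitian, conjTranspose_eq_transpose_of_trivial]
    simp only [transpose_mul, transpose_transpose, hK, Matrix.mul_assoc]
  set U : Matrix m m ℝ := hH.eigenvectorUnitary.1 with hU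
  have hUU : Uᵀ * U = 1 := by
    have := Unitary.coe_star_mul_self hH.eigenvectorUnitary
    rwa [Matrix.star_eq_conjTranspose, conjTranspose_eq_transpose_of_trivial] at this
  have hspec : M⁻¹ * K * M⁻¹ᵀ = U * diagonal hH.eigenvalues * Uᵀ := by
    have := hH.spectral_theorem
    rw [Unitary.conjStarAlgAut_apply] at this
    simpa [Matrix.star_eq_conjTranspose] using this
  refine ⟨Uᵀ * M⁻¹, hH.eigenvalues, ?_, ?_⟩
  · have h1 : M⁻¹ * (M * Mᵀ) * M⁻¹ᵀ = 1 := by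
      rw [← Matrix.mul_assoc, nonsing_inv_mul M hu, Matrix.one_mul, transpose_nonsing_inv,
        mul_nonsing_inv _ hu']
    calc Uᵀ * M⁻¹ * (M * Mᵀ) * (Uᵀ * M⁻¹)ᵀ
        = Uᵀ * (M⁻¹ * (M * Mᵀ) * M⁻¹ᵀ) * U := by
          simp only [transpose_mul, transpose_transpose, Matrix.mul_assoc]
      _ = 1 := by rw [h1, Matrix.mul_one, hUU]
  · calc Uᵀ * M⁻¹ * K * (Uᵀ * M⁻¹)ᵀ
        = Uᵀ * (M⁻¹ * K * M⁻¹ᵀ) * U := by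
          simp only [transpose_mul, transpose_transpose, Matrix.mul_assoc]
      _ = (Uᵀ * U) * diagonal hH.eigenvalues * (Uᵀ * U) :=
          (congrArg (fun X => Uᵀ * X * U) hspec).trans (by simp only [Matrix.mul_assoc])
      _ = _ := by rw [hUU, Matrix.one_mul, Matrix.mul_one]

lemma exists_coercive {P : Matrix m m ℝ} (hP : P.PosDef) :
    ∃ c : ℝ, 0 < c ∧ ∀ x : m → ℝ, c * ∑ i, x i ^ 2 ≤ x ⬝ᵥ P *ᵥ x := by
  obtain ⟨M, hM, rfl⟩ := exists_mul_transpose_eq hP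
  set N := (Mᵀ)⁻¹ with hN
  set C : ℝ := ∑ i, ∑ j, N i j ^ 2 with hC
  have hC0 : 0 ≤ C := Finset.sum_nonneg fun i _ => Finset.sum_nonneg fun j _ => sq_nonneg _
  refine ⟨(C + 1)⁻¹, by positivity, fun x => ?_⟩
  set y := Mᵀ *ᵥ x with hy
  have hxy : x = N *ᵥ y := by
    rw [hy, mulVec_mulVec, hN, nonsing_inv_mul _ (by rw [det_transpose]; exact hM.isUnit),
      one_mulVec]
  have hq : x ⬝ᵥ (M * Mᵀ) *ᵥ x = ∑ j, y j ^ 2 := by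
    rw [← mulVec_mulVec, dotProduct_mulVec, ← mulVec_transpose, ← hy, dotProduct]
    simp only [sq]
  have hb : ∑ i, x i ^ 2 ≤ C * ∑ j, y j ^ 2 := by
    rw [hC, Finset.sum_mul]
    refine Finset.sum_le_sum fun i _ => ?_
    rw [hxy]
    exact Finset.sum_mul_sq_le_sq_mul_sq _ _ _
  rw [hq, inv_mul_le_iff₀ (by positivity)]
  have : 0 ≤ ∑ j, y j ^ 2 := Finset.sum_nonneg fun j _ => sq_nonneg _
  nlinarith

end Matrices

section Canonical

open Matrix

variable {m n : Type*} [Fintype m] [DecidableEq m] [Fintype n] [DecidableEq n]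
  {A : Matrix m m ℝ} {B : Matrix m n ℝ} {E : Matrix n n ℝ} {W : Matrix m m ℝ} {s : m → ℝ}

/-- Completing the square: the inverse covariance form is the sum of the squared normalized
residuals of the regression on the second group, and the form of the second group. -/
lemma inv_form_eq (hS : (fromBlocks A B Bᵀ E).det ≠ 0) (hE : E.PosDef) (hA : Aᵀ = A)
    (hWA : W * A * Wᵀ = 1) (hWK : W * (B * E⁻¹ * Bᵀ) * Wᵀ = diagonal s) (hs : ∀ k, s k < 1)
    (x : m → ℝ) (y : n → ℝ) :
    Sum.elim x y ⬝ᵥ (fromBlocks A B Bᵀ E)⁻¹ *ᵥ Sum.elim x y =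
      ∑ k, ((W *ᵥ x) k - ((W * B * E⁻¹) *ᵥ y) k) ^ 2 / (1 - s k) + y ⬝ᵥ E⁻¹ *ᵥ y := by
  set S := fromBlocks A B Bᵀ E with hSdef
  have hEu : IsUnit E.det := hE.det_pos.ne'.isUnit
  have hEt : Eᵀ = E := by
    have := hE.1; rwa [Matrix.IsHermitian, conjTranspose_eq_transpose_of_trivial] at this
  have hEit : E⁻¹ᵀ = E⁻¹ := by rw [transpose_nonsing_inv, hEt]
  -- write the argument as `S` applied to a vector `(p, q)`
  obtain ⟨p, q, hpq⟩ : ∃ p q, Sum.elim x y = S *ᵥ Sum.elim p q := by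
    refine ⟨(S⁻¹ *ᵥ Sum.elim x y) ∘ Sum.inl, (S⁻¹ *ᵥ Sum.elim x y) ∘ Sum.inr, ?_⟩
    rw [Sum.elim_comp_inl_inr, mulVec_mulVec, mul_nonsing_inv _ hS.isUnit, one_mulVec]
  have hblock := hpq
  rw [hSdef, fromBlocks_mulVec] at hblock
  have hx : x = A *ᵥ p + B *ᵥ q := by
    have := congrArg (fun f => f ∘ Sum.inl) hblock; simpa using this
  have hy : y = Bᵀ *ᵥ p + E *ᵥ q := by
    have := congrArg (fun f => f ∘ Sum.inr) hblock; simpa using this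
  set K := B * E⁻¹ * Bᵀ with hK
  have hKt : Kᵀ = K := by
    rw [hK, transpose_mul, transpose_mul, transpose_transpose, hEit, Matrix.mul_assoc]
  set R := A - K with hR
  have hres : W *ᵥ x - (W * B * E⁻¹) *ᵥ y = (W * R) *ᵥ p := by
    have h1 : (W * B * E⁻¹) *ᵥ (E *ᵥ q) = (W * B) *ᵥ q := by
      rw [mulVec_mulVec, Matrix.mul_assoc, nonsing_inv_mul _ hEu, Matrix.mul_one]
    rw [hx, hy, mulVec_add, mulVec_add, h1, mulVec_mulVec, mulVec_mulVec, mulVec_mulVec, hR,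
      Matrix.mul_sub, sub_mulVec, hK, ← Matrix.mul_assoc, ← Matrix.mul_assoc]
    abel
  -- the residual covariance `R = A - K` is diagonalized by `W` as well
  have hWR : W * R * Wᵀ = diagonal fun k => 1 - s k := by
    rw [hR, Matrix.mul_sub, Matrix.sub_mul, hWA, hWK, ← diagonal_one, diagonal_sub]
  set G := diagonal fun k => (1 - s k)⁻¹ with hG
  have hWAW : IsUnit W.det := by
    have h := congrArg Matrix.det hWA
    rw [det_mul, det_mul, det_one, mul_assoc] at h
    exact IsUnit.of_mul_eq_one _ h
  have hGR : (W * R)ᵀ * G * (W * R) = R := by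
    have h1 : (diagonal fun k => 1 - s k) * G = 1 := by
      rw [hG, diagonal_mul_diagonal, ← diagonal_one]
      congr 1
      ext k
      exact mul_inv_cancel₀ (by linarith [hs k])
    have hRt : Rᵀ = R := by rw [hR, transpose_sub, hA, hKt]
    have h2 : W * ((W * R)ᵀ * G * (W * R)) = W * R := by
      rw [transpose_mul, hRt]
      calc W * (R * Wᵀ * G * (W * R)) = (W * R * Wᵀ) * G * (W * R) := by
            simp only [Matrix.mul_assoc]
        _ = W * R := by rw [hWR, h1, Matrix.one_mul]
    have h3 := congrArg (fun X => W⁻¹ * X) h2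
    simpa [← Matrix.mul_assoc, nonsing_inv_mul _ hWAW] using h3
  have hsum : ∑ k, ((W *ᵥ x) k - ((W * B * E⁻¹) *ᵥ y) k) ^ 2 / (1 - s k) = p ⬝ᵥ R *ᵥ p := by
    conv_rhs => rw [← hGR, ← mulVec_mulVec, ← mulVec_mulVec, dotProduct_mulVec, ← mulVec_transpose,
      transpose_transpose, ← hres, hG]
    rw [dotProduct]
    refine Finset.sum_congr rfl fun k _ => ?_
    rw [mulVec_diagonal, Pi.sub_apply, div_eq_mul_inv]
    ring
  have hEy : E⁻¹ *ᵥ y = (E⁻¹ * Bᵀ) *ᵥ p + q := by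
    rw [hy, mulVec_add, mulVec_mulVec, mulVec_mulVec, nonsing_inv_mul _ hEu, one_mulVec]
  have hBE : ∀ v : n → ℝ, (Bᵀ *ᵥ p) ⬝ᵥ v = p ⬝ᵥ B *ᵥ v := fun v => by
    rw [dotProduct_mulVec, mulVec_transpose]
  have hEq : ∀ v : n → ℝ, (E *ᵥ q) ⬝ᵥ v = q ⬝ᵥ E *ᵥ v := fun v => by
    rw [dotProduct_mulVec, ← mulVec_transpose, hEt]
  have hinv : S⁻¹ *ᵥ Sum.elim x y = Sum.elim p q := by
    rw [hpq, mulVec_mulVec, nonsing_inv_mul _ hS.isUnit, one_mulVec]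
  rw [hinv, hsum, hEy, sumElim_dotProduct_sumElim, hR, sub_mulVec, dotProduct_sub]
  conv_lhs => rw [hx, hy]
  conv_rhs => rw [hy]
  have e1 : (A *ᵥ p) ⬝ᵥ p = p ⬝ᵥ A *ᵥ p := dotProduct_comm _ _
  have e2 : (B *ᵥ q) ⬝ᵥ p = p ⬝ᵥ B *ᵥ q := dotProduct_comm _ _
  have e3 : B *ᵥ ((E⁻¹ * Bᵀ) *ᵥ p) = K *ᵥ p := by
    rw [mulVec_mulVec, hK, Matrix.mul_assoc]
  have e4 : q ⬝ᵥ E *ᵥ ((E⁻¹ * Bᵀ) *ᵥ p) = p ⬝ᵥ B *ᵥ q := by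
    rw [mulVec_mulVec, ← Matrix.mul_assoc, mul_nonsing_inv _ hEu, Matrix.one_mul,
      dotProduct_comm, hBE]
  simp only [add_dotProduct, dotProduct_add, hBE, hEq, e1, e2, e3, e4]
  ring

end Canonical

section

open Matrix

/-- Canonical coordinates of the bipartition `A`, `Aᶜ` of a Gaussian vector with covariance `S`:
`P x` are uncorrelated normalized coordinates of the first group, and `H x` are their regressions
on the second group, which are uncorrelated with variances `corrSq`, the squared canonical
correlations. Working with regressions instead of normalized coordinates of the second group avoids
dividing by correlations that may vanish. -/
structure CanonicalCoordinates {D : ℕ} (S : Matrix (Fin D) (Fin D) ℝ) (A : Finset (Fin D)) where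
  /-- the squared canonical correlations -/
  corrSq : A → ℝ
  /-- the coordinates of the first group -/
  P : Matrix A (Fin D) ℝ
  /-- their regressions on the second group -/
  H : Matrix A (Fin D) ℝ
  /-- the inverse covariance form of the second group -/
  q : (Fin D → ℝ) → ℝ
  P_apply : ∀ k, ∀ i ∉ A, P k i = 0
  H_apply : ∀ k, ∀ i ∈ A, H k i = 0
  P_cov : P * S * Pᵀ = 1
  H_cov : H * S * Hᵀ = diagonal corrSq
  P_H_cov : P * S * Hᵀ = diagonal corrSq
  dependsOn_q : DependsOn q (Aᶜ : Finset (Fin D))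
  measurable_q : Measurable q
  form_eq : (∀ k, corrSq k < 1) → ∀ x, x ⬝ᵥ S⁻¹ *ᵥ x =
    ∑ k, ((P *ᵥ x) k - (H *ᵥ x) k) ^ 2 / (1 - corrSq k) + q x
  coercive : ∃ c : ℝ, 0 < c ∧ ∀ x, c * ∑ i ∈ A, x i ^ 2 ≤ ∑ k, (P *ᵥ x) k ^ 2 ∧
    c * ∑ i ∈ Aᶜ, x i ^ 2 ≤ q x
  isCanonicalCorrelation : ∀ k, 0 < corrSq k → IsCanonicalCorrelation S A √(corrSq k)
  card_le_rank : Fintype.card {k // corrSq k ≠ 0} ≤ (covBlock S A Aᶜ).rank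

variable {D : ℕ} {S : Matrix (Fin D) (Fin D) ℝ}

/-- The matrix restricting a vector to the coordinates in `A`. -/
def selectRows (A : Finset (Fin D)) : Matrix A (Fin D) ℝ :=
  (1 : Matrix (Fin D) (Fin D) ℝ).submatrix Subtype.val id

lemma selectRows_mulVec (A : Finset (Fin D)) (x : Fin D → ℝ) :
    selectRows A *ᵥ x = fun i : A => x i := by
  ext i
  simp [selectRows, mulVec, dotProduct, Matrix.one_apply]

lemma selectRows_mul_mul (A B : Finset (Fin D)) :
    selectRows A * S * (selectRows B)ᵀ = covBlock S A B := by
  ext i j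
  simp [selectRows, covBlock, Matrix.mul_apply, Matrix.one_apply]

/-- Diagonalize the covariance `B * E⁻¹ * Bᵀ` of the regression of the first group on the second
one simultaneously with the covariance of the first group. -/
lemma exists_canonicalCoordinates (hS : S.PosDef) (A : Finset (Fin D)) :
    Nonempty (CanonicalCoordinates S A) := by
  have hSt : Sᵀ = S := by
    have := hS.1; rwa [Matrix.IsHermitian, conjTranspose_eq_transpose_of_trivial] at this
  set A₁ := covBlock S A A with hA₁
  set B := covBlock S A Aᶜ with hB
  set E := covBlock S Aᶜ Aᶜ with hE
  have hA₁p : A₁.PosDef := hS.submatrix Subtype.val_injective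
  have hEp : E.PosDef := hS.submatrix Subtype.val_injective
  have hA₁t : A₁ᵀ = A₁ := by rw [hA₁, covBlock, transpose_submatrix, hSt]
  have hEt : Eᵀ = E := by rw [hE, covBlock, transpose_submatrix, hSt]
  have hEit : E⁻¹ᵀ = E⁻¹ := by rw [transpose_nonsing_inv, hEt]
  have hBt : covBlock S Aᶜ A = Bᵀ := by rw [hB, covBlock, covBlock, transpose_submatrix, hSt]
  have hEu : IsUnit E.det := hEp.det_pos.ne'.isUnit
  have hKt : (B * E⁻¹ * Bᵀ)ᵀ = B * E⁻¹ * Bᵀ := by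
    rw [transpose_mul, transpose_mul, transpose_transpose, hEit, Matrix.mul_assoc]
  obtain ⟨W, s, hWA, hWK⟩ := exists_simultaneous_diagonalization hA₁p hKt
  have hWu : IsUnit W.det := by
    have h := congrArg Matrix.det hWA
    rw [det_mul, det_mul, det_one, mul_assoc] at h
    exact IsUnit.of_mul_eq_one _ h
  let e : A ⊕ (Aᶜ : Finset (Fin D)) ≃ Fin D :=
    (Equiv.sumCongr (Equiv.refl _) (Equiv.subtypeEquivRight fun i => by simp)).trans
      (Equiv.sumCompl fun i => i ∈ A)
  have heS : S.submatrix e e = fromBlocks A₁ B Bᵀ E := by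
    rw [← hBt]
    ext i j
    rcases i with i | i <;> rcases j with j | j <;> rfl
  have hxe : ∀ x : Fin D → ℝ, x ∘ e =
      Sum.elim (fun i : A => x i) fun i : (Aᶜ : Finset (Fin D)) => x i := fun x => by
    ext i; rcases i with i | i <;> rfl
  have hPx : ∀ x, (W * selectRows A) *ᵥ x = W *ᵥ fun i : A => x i := fun x => by
    rw [← mulVec_mulVec, selectRows_mulVec]
  have hHx : ∀ x, (W * B * E⁻¹ * selectRows Aᶜ) *ᵥ x =
      (W * B * E⁻¹) *ᵥ fun i : (Aᶜ : Finset (Fin D)) => x i := fun x => by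
    rw [← mulVec_mulVec, selectRows_mulVec]
  have hcross : W * B * (W * B * E⁻¹)ᵀ = diagonal s := by
    rw [← hWK, transpose_mul, transpose_mul, hEit]
    simp only [Matrix.mul_assoc]
  refine ⟨⟨s, W * selectRows A, W * B * E⁻¹ * selectRows Aᶜ,
    fun x => (fun i : (Aᶜ : Finset (Fin D)) => x i) ⬝ᵥ E⁻¹ *ᵥ fun i => x i,
    ?_, ?_, ?_, ?_, ?_, ?_, ?_, ?_, ?_, ?_, ?_⟩⟩
  · intro k i hi
    rw [Matrix.mul_apply]
    refine Finset.sum_eq_zero fun j _ => ?_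
    rw [selectRows, submatrix_apply, one_apply_ne
      (show ((j : Fin D) ≠ id i) from fun h : (j : Fin D) = i => hi (h ▸ j.2)),
      mul_zero]
  · intro k i hi
    rw [Matrix.mul_apply]
    refine Finset.sum_eq_zero fun j _ => ?_
    rw [selectRows, submatrix_apply,
      one_apply_ne (show ((j : Fin D) ≠ id i) from fun h => Finset.mem_compl.1 j.2 (h.symm ▸ hi)),
      mul_zero]
  · calc _ = W * (selectRows A * S * (selectRows A)ᵀ) * Wᵀ := by
          simp only [transpose_mul, Matrix.mul_assoc]
      _ = _ := by rw [selectRows_mul_mul, hWA]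
  · calc _ = W * B * E⁻¹ * (selectRows Aᶜ * S * (selectRows Aᶜ)ᵀ) * (W * B * E⁻¹)ᵀ := by
          simp only [transpose_mul, Matrix.mul_assoc]
      _ = W * B * (E⁻¹ * E) * (W * B * E⁻¹)ᵀ := by
          rw [selectRows_mul_mul]; simp only [Matrix.mul_assoc, ← hE]
      _ = _ := by rw [nonsing_inv_mul _ hEu, Matrix.mul_one, hcross]
  · calc _ = W * (selectRows A * S * (selectRows Aᶜ)ᵀ) * (W * B * E⁻¹)ᵀ := by
          simp only [transpose_mul, Matrix.mul_assoc]
      _ = _ := by rw [selectRows_mul_mul, hcross]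
  · intro x y h
    have : (fun i : (Aᶜ : Finset (Fin D)) => x i) =
        fun i : (Aᶜ : Finset (Fin D)) => y i :=
      funext fun i => h i (Finset.mem_coe.2 i.2)
    simp only [this]
  · simp only [dotProduct, mulVec]
    fun_prop
  · intro hs1 x
    have h1 : x ⬝ᵥ S⁻¹ *ᵥ x = (x ∘ e) ⬝ᵥ (S.submatrix e e)⁻¹ *ᵥ (x ∘ e) := by
      rw [inv_submatrix_equiv, submatrix_mulVec_equiv, Function.comp_assoc, e.self_comp_symm,
        Function.comp_id, comp_equiv_dotProduct_comp_equiv]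
    rw [h1, hxe, heS, hPx, hHx]
    refine inv_form_eq ?_ hEp hA₁t hWA hWK hs1 _ _
    rw [← heS, det_submatrix_equiv_self]
    exact hS.det_pos.ne'
  · have hinv : A₁⁻¹ = Wᵀ * W := by
      refine inv_eq_right_inv ?_
      rw [← Matrix.mul_assoc, mul_eq_one_comm, ← Matrix.mul_assoc, hWA]
    obtain ⟨c₁, hc₁, h₁⟩ := exists_coercive hA₁p.inv
    obtain ⟨c₂, hc₂, h₂⟩ := exists_coercive hEp.inv
    refine ⟨min c₁ c₂, lt_min hc₁ hc₂, fun x => ⟨?_, ?_⟩⟩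
    · rw [hPx]
      have h := h₁ fun i : A => x i
      rw [hinv, ← mulVec_mulVec, dotProduct_mulVec, ← mulVec_transpose, transpose_transpose,
        dotProduct, Finset.sum_coe_sort A fun i => x i ^ 2] at h
      simp only [← sq] at h
      refine le_trans (mul_le_mul_of_nonneg_right (min_le_left _ _) ?_) h
      exact Finset.sum_nonneg fun i _ => sq_nonneg _
    · have h := h₂ fun i : (Aᶜ : Finset (Fin D)) => x i
      rw [Finset.sum_coe_sort Aᶜ fun i => x i ^ 2] at h
      refine le_trans (mul_le_mul_of_nonneg_right (min_le_right _ _) ?_) h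
      exact Finset.sum_nonneg fun i _ => sq_nonneg _
  · intro k hk
    have hr : 0 < √(s k) := Real.sqrt_pos.2 hk
    have hsq : √(s k) * √(s k) = s k := Real.mul_self_sqrt hk.le
    have hKW : B * E⁻¹ * Bᵀ * Wᵀ = A₁ * Wᵀ * diagonal s := by
      have h : W * (B * E⁻¹ * Bᵀ * Wᵀ) = W * (A₁ * Wᵀ * diagonal s) := by
        rw [← Matrix.mul_assoc, hWK, ← Matrix.mul_assoc, ← Matrix.mul_assoc, hWA, Matrix.one_mul]
      have h' := congrArg (fun X => W⁻¹ * X) h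
      simpa only [nonsing_inv_mul_cancel_left _ _ hWu] using h'
    set a : A → ℝ := Wᵀ *ᵥ Pi.single k 1 with ha
    have hKa : (B * E⁻¹ * Bᵀ) *ᵥ a = s k • A₁ *ᵥ a := by
      have hd : diagonal s *ᵥ (Pi.single k 1 : A → ℝ) = s k • Pi.single k 1 := by
        ext i
        by_cases h : i = k
        · subst h; simp [mulVec_diagonal]
        · simp [h]
      rw [ha, mulVec_mulVec, hKW, ← mulVec_mulVec, hd, mulVec_smul, ← mulVec_mulVec]
    refine ⟨hr.le, a, (√(s k))⁻¹ • (E⁻¹ * Bᵀ) *ᵥ a, Or.inl fun h0 => ?_, ?_, ?_⟩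
    · have h1 : (W * A₁ * Wᵀ) *ᵥ (Pi.single k 1 : A → ℝ) = 0 := by
        rw [← mulVec_mulVec, ← ha, h0, mulVec_zero]
      rw [hWA, one_mulVec] at h1
      simpa using congrFun h1 k
    · rw [← hB, mulVec_smul, mulVec_mulVec, ← Matrix.mul_assoc, hKa, smul_smul]
      congr 1
      field_simp
      rw [sq, hsq]
    · rw [hBt, mulVec_smul, smul_smul, mul_inv_cancel₀ hr.ne', one_smul, ← hE]
      have hEB : E * (E⁻¹ * Bᵀ) = Bᵀ := by
        rw [← Matrix.mul_assoc, mul_nonsing_inv _ hEu, Matrix.one_mul]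
      rw [mulVec_mulVec a E, hEB]
  · rw [← rank_diagonal, ← hWK, Matrix.mul_assoc, Matrix.mul_assoc, Matrix.mul_assoc]
    exact (rank_mul_le_right _ _).trans (rank_mul_le_left _ _)

namespace CanonicalCoordinates

variable {A : Finset (Fin D)} (c : CanonicalCoordinates S A)

lemma dependsOn_P : DependsOn (fun x => c.P *ᵥ x) A := fun x y h => by
  ext k
  simp only [mulVec, dotProduct]
  refine Finset.sum_congr rfl fun i _ => ?_
  by_cases hi : i ∈ A
  · rw [h i hi]
  · simp [c.P_apply k i hi]

lemma dependsOn_H : DependsOn (fun x => c.H *ᵥ x) (Aᶜ : Finset (Fin D)) := fun x y h => by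
  ext k
  simp only [mulVec, dotProduct]
  refine Finset.sum_congr rfl fun i _ => ?_
  by_cases hi : i ∈ A
  · simp [c.H_apply k i hi]
  · rw [h i (by simpa using hi)]

lemma corrSq_eq (k : A) : c.corrSq k = c.H k ⬝ᵥ S *ᵥ c.H k := by
  have h := congrFun (congrFun c.H_cov k) k
  rw [diagonal_apply_eq] at h
  rw [← h, Matrix.mul_assoc, Matrix.mul_apply]
  refine Finset.sum_congr rfl fun i _ => ?_
  rw [Matrix.mul_apply]
  rfl

lemma corrSq_nonneg (hS : S.PosDef) (k : A) : 0 ≤ c.corrSq k := by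
  rw [c.corrSq_eq]
  simpa using hS.posSemidef.dotProduct_mulVec_nonneg (c.H k)

lemma H_mulVec_eq_zero (hS : S.PosDef) {k : A} (hk : c.corrSq k = 0) (x : Fin D → ℝ) :
    (c.H *ᵥ x) k = 0 := by
  have h0 : c.H k = 0 := by
    by_contra h
    have := hS.dotProduct_mulVec_pos h
    rw [star_trivial, ← c.corrSq_eq, hk] at this
    exact this.false
  rw [mulVec, h0, zero_dotProduct]

end CanonicalCoordinates

end

/-! ### Tameness of Gaussian functions -/

section

variable {ι : Type*} {A : Finset ι} {Φ : (ι → ℝ) → ℝ}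

lemma exp_neg_mul_sq_le_weight {c : ℝ} (hc : 0 < c) (t : ℝ) :
    Real.exp (-(c * t ^ 2)) ≤ (1 + 1 / c) * weight t := by
  have h1 : c * t ^ 2 + 1 ≤ Real.exp (c * t ^ 2) := Real.add_one_le_exp _
  have h2 : 0 ≤ c * t ^ 2 := by positivity
  rw [Real.exp_neg, weight, ← div_eq_mul_inv, inv_eq_one_div,
    div_le_div_iff₀ (Real.exp_pos _) (by positivity), one_mul]
  have h3 : 1 + t ^ 2 ≤ (1 + 1 / c) * (c * t ^ 2 + 1) := by
    have : (1 + 1 / c) * (c * t ^ 2 + 1) = 1 + t ^ 2 + (c * t ^ 2 + 1 / c) := by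
      field_simp
      ring
    rw [this]
    have : 0 ≤ 1 / c := by positivity
    linarith
  exact h3.trans (mul_le_mul_of_nonneg_left h1 (by positivity))

lemma tame_exp_neg (hΦ : Measurable Φ) (hA : DependsOn Φ A) {c : ℝ} (hc : 0 < c)
    (h : ∀ x, c * ∑ i ∈ A, x i ^ 2 ≤ Φ x) : Tame A fun x => Real.exp (-Φ x) := by
  refine ⟨(hΦ.neg).exp, fun x y hxy => by rw [hA hxy], (1 + 1 / c) ^ A.card, by positivity,
    fun x => ?_⟩
  rw [Real.abs_exp, ← Finset.prod_const, ← Finset.prod_mul_distrib]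
  calc Real.exp (-Φ x) ≤ Real.exp (∑ i ∈ A, -(c * x i ^ 2)) := by
        rw [Finset.sum_neg_distrib, ← Finset.mul_sum]
        exact Real.exp_le_exp.2 (neg_le_neg (h x))
    _ = ∏ i ∈ A, Real.exp (-(c * x i ^ 2)) := Real.exp_sum _ _
    _ ≤ _ := Finset.prod_le_prod (fun i _ => (Real.exp_pos _).le)
        fun i _ => exp_neg_mul_sq_le_weight hc _

lemma exists_abs_exp_mul_pow_le {a : ℝ} (ha : 0 < a) (n : ℕ) :
    ∃ K : ℝ, ∀ t : ℝ, |Real.exp (-(a * t ^ 2)) * t ^ n| ≤ K := by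
  refine ⟨1 + n.factorial / a ^ n, fun t => ?_⟩
  have h1 : |t| ^ n ≤ 1 + t ^ (2 * n) := by
    rw [pow_mul, ← sq_abs, ← pow_mul, mul_comm 2 n, pow_mul]
    nlinarith [sq_nonneg (|t| ^ n - 1), pow_nonneg (abs_nonneg t) n]
  have h2 : t ^ (2 * n) ≤ n.factorial / a ^ n * Real.exp (a * t ^ 2) := by
    have h := Real.pow_div_factorial_le_exp (a * t ^ 2) (by positivity) n
    rw [div_le_iff₀ (by positivity), mul_pow, ← pow_mul] at h
    rw [div_mul_eq_mul_div, le_div_iff₀ (by positivity)]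
    linarith
  have h3 : 1 ≤ Real.exp (a * t ^ 2) := Real.one_le_exp (by positivity)
  rw [abs_mul, Real.abs_exp, abs_pow, Real.exp_neg, inv_mul_le_iff₀ (Real.exp_pos _)]
  linarith

lemma exists_abs_exp_mul_prod_pow_le {κ : Type*} [Fintype κ] {a : κ → ℝ} (ha : ∀ k, 0 < a k)
    (n : κ → ℕ) :
    ∃ K : ℝ, ∀ y : κ → ℝ, |Real.exp (-∑ k, a k * y k ^ 2) * ∏ k, y k ^ n k| ≤ K := by
  choose K hK using fun k => exists_abs_exp_mul_pow_le (ha k) (n k)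
  refine ⟨∏ k, K k, fun y => ?_⟩
  rw [← Finset.sum_neg_distrib, Real.exp_sum, ← Finset.prod_mul_distrib, Finset.abs_prod]
  exact Finset.prod_le_prod (fun k _ => abs_nonneg _) fun k _ => hK k _

open Matrix

variable {D : ℕ} {S : Matrix (Fin D) (Fin D) ℝ}

lemma gaussianDensity_nonneg (x : Fin D → ℝ) : 0 ≤ gaussianDensity S x := by
  unfold gaussianDensity
  positivity

lemma sqrt_gaussianDensity (x : Fin D → ℝ) : √(gaussianDensity S x) =
    √(1 / √((2 * Real.pi) ^ D * S.det)) * Real.exp (-((x ⬝ᵥ S⁻¹ *ᵥ x) / 4)) := by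
  rw [gaussianDensity, Real.sqrt_mul (by positivity), ← Real.exp_half]
  congr 2
  ring

lemma tame_sqrt_gaussianDensity (hS : S.PosDef) :
    Tame Finset.univ fun x => √(gaussianDensity S x) := by
  simp only [sqrt_gaussianDensity]
  obtain ⟨c, hc, h⟩ := exists_coercive hS.inv
  refine (tame_exp_neg (c := c / 4) (by fun_prop) (fun x y hxy => ?_) (by positivity)
    fun x => ?_).const_mul _
  · rw [show x = y from funext fun i => hxy i (by simp)]
  · linarith [h x]

end

/-! ### Truncated coupling of the two groups -/

section

open Matrix ProbabilityTheory

/-- The truncation error of one canonical pair `X = c ⬝ᵥ z`, `Z = d ⬝ᵥ z`. Since `d` is the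
regression of `c`, the residual `X - Z` is independent of `Z`. -/
lemma lintegral_sq_truncFactor_sub_one_le {ι : Type*} [Fintype ι] {c d : ι → ℝ} {s θ : ℝ}
    (hs0 : 0 < s) (hs1 : s < 1) (hcc : c ⬝ᵥ c = 1) (hcd : c ⬝ᵥ d = s) (hdd : d ⬝ᵥ d = s)
    (h0 : 0 < θ) (h1 : θ < 1) (hs : √s ≤ θ ^ 2) (N : ℕ) :
    ∫⁻ z, ENNReal.ofReal ((truncFactor N ((c ⬝ᵥ z) * (d ⬝ᵥ z) / (2 * (1 - s))) - 1) ^ 2)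
      ∂stdNormal ι ≤ ENNReal.ofReal ((θ ^ N) ^ 2 * (1 / (1 - θ))) := by
  set G : ℝ → ℝ → ENNReal := fun z w => ENNReal.ofReal
    (Real.exp (2 * (|(w + z) * z / (2 * (1 - s))| / θ - (w + z) * z / (2 * (1 - s))))) with hG
  have hGm : Measurable fun p : ℝ × ℝ => G p.1 p.2 := by
    simp only [hG]
    fun_prop
  have hind : IndepFun (fun z => d ⬝ᵥ z) (fun z => (c - d) ⬝ᵥ z) (stdNormal ι) :=
    indepFun_dotProduct_stdNormal _ _ (by rw [dotProduct_sub, dotProduct_comm d c, hcd, hdd, sub_self])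
  have hm : ∀ e : ι → ℝ, Measurable fun z => e ⬝ᵥ z := fun e => by
    simp only [dotProduct]
    fun_prop
  have hmap := (indepFun_iff_map_prod_eq_prod_map_map (hm d).aemeasurable
    (hm (c - d)).aemeasurable).1 hind
  rw [map_dotProduct_stdNormal, map_dotProduct_stdNormal] at hmap
  have hvar : ((c - d) ⬝ᵥ (c - d)).toNNReal = 1 - s.toNNReal := by
    rw [dotProduct_sub, sub_dotProduct, sub_dotProduct, dotProduct_comm d c, hcc, hcd, hdd,
      sub_self, sub_zero]
    have hs1' : s.toNNReal ≤ 1 := by rw [← Real.toNNReal_one]; exact Real.toNNReal_le_toNNReal hs1.le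
    refine NNReal.eq ?_
    rw [NNReal.coe_sub hs1', Real.coe_toNNReal _ (sub_pos.2 hs1).le, Real.coe_toNNReal _ hs0.le,
      NNReal.coe_one]
  rw [hvar, hdd] at hmap
  have hcoe : (s.toNNReal : ℝ) = s := Real.coe_toNNReal _ hs0.le
  calc _ ≤ ∫⁻ z, ENNReal.ofReal ((θ ^ N) ^ 2) * G (d ⬝ᵥ z) ((c - d) ⬝ᵥ z) ∂stdNormal ι := by
        refine lintegral_mono fun z => ?_
        rw [hG, ← ENNReal.ofReal_mul (by positivity), sub_dotProduct, sub_add_cancel]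
        exact ENNReal.ofReal_le_ofReal (sq_truncFactor_sub_one_le _ _ h0 h1.le)
    _ = ENNReal.ofReal ((θ ^ N) ^ 2) * ∫⁻ z, G (d ⬝ᵥ z) ((c - d) ⬝ᵥ z) ∂stdNormal ι :=
        lintegral_const_mul' _ _ ENNReal.ofReal_ne_top
    _ = ENNReal.ofReal ((θ ^ N) ^ 2) * ∫⁻ z, ∫⁻ w, G z w ∂gaussianReal 0 (1 - s.toNNReal)
          ∂gaussianReal 0 s.toNNReal := by
        rw [← lintegral_prod _ hGm.aemeasurable, ← hmap,
          lintegral_map hGm ((hm d).prodMk (hm (c - d)))]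
    _ ≤ ENNReal.ofReal ((θ ^ N) ^ 2) * ENNReal.ofReal (1 / (1 - θ)) := by
        gcongr
        have h := lintegral_exp_coupling_le (s := s.toNNReal) (Real.toNNReal_pos.2 hs0)
          (by rw [← Real.toNNReal_one]; exact (Real.toNNReal_lt_toNNReal_iff one_pos).2 hs1)
          h0 h1 (by rwa [hcoe])
        rwa [hcoe] at h
    _ = _ := (ENNReal.ofReal_mul (by positivity)).symm

lemma truncFactor_one_zero : truncFactor 1 0 = 1 := by simp [truncFactor, expTaylor]

namespace CanonicalCoordinates

variable {D : ℕ} {S : Matrix (Fin D) (Fin D) ℝ} {A : Finset (Fin D)}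
  (c : CanonicalCoordinates S A) (N : ℕ)

/-- The contribution of the `k`-th canonical pair to the exponent of the square root of the
density that couples the two groups. -/
noncomputable def coupling (x : Fin D → ℝ) (k : A) : ℝ :=
  (c.P *ᵥ x) k * ((c.H *ᵥ x) k / (2 * (1 - c.corrSq k)))

open Classical in
/-- The number of Taylor terms kept for the `k`-th canonical pair: uncorrelated pairs need only
the constant term. -/
noncomputable def order (k : A) : ℕ := if c.corrSq k = 0 then 1 else N

/-- The square root of the density, with the exponential of each coupling term replaced by its
Taylor polynomial. -/
noncomputable def approximant (x : Fin D → ℝ) : ℝ :=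
  √(gaussianDensity S x) * ∏ k, truncFactor (c.order N k) (c.coupling x k)

/-- At most `l` canonical correlations are nonzero, so there are at most `N ^ l` Taylor terms in
all. -/
lemma prod_order_le {l : ℕ} (hN : 1 ≤ N) (hl : (covBlock S A Aᶜ).rank ≤ l) :
    ∏ k, c.order N k ≤ N ^ l := by
  classical
  have h : ∏ k, c.order N k = N ^ Fintype.card {k // c.corrSq k ≠ 0} := by
    simp only [order, Finset.prod_ite, Finset.prod_const, one_pow, one_mul, Fintype.card_subtype]
  rw [h]
  exact Nat.pow_le_pow_right hN (c.card_le_rank.trans hl)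

lemma measurable_P (k : A) : Measurable fun x => (c.P *ᵥ x) k := by
  simp only [mulVec, dotProduct]
  fun_prop

lemma measurable_H (k : A) : Measurable fun x => (c.H *ᵥ x) k := by
  simp only [mulVec, dotProduct]
  fun_prop

lemma measurable_coupling (k : A) : Measurable fun x => c.coupling x k :=
  (c.measurable_P k).mul ((c.measurable_H k).div_const _)

/-- In canonical coordinates the exponent splits into a part for each group and the couplings;
the truncation factors turn the exponentials of the couplings into Taylor polynomials. -/
lemma approximant_eq (hs : ∀ k, c.corrSq k < 1) (x : Fin D → ℝ) :
    c.approximant N x = √(1 / √((2 * Real.pi) ^ D * S.det)) *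
      Real.exp (-∑ k, 1 / (4 * (1 - c.corrSq k)) * (c.P *ᵥ x) k ^ 2) *
      (Real.exp (-(c.q x / 4)) *
        Real.exp (-∑ k, 1 / (4 * (1 - c.corrSq k)) * (c.H *ᵥ x) k ^ 2)) *
      ∏ k, expTaylor (c.order N k) (c.coupling x k) := by
  have h : -((x ⬝ᵥ S⁻¹ *ᵥ x) / 4) + ∑ k, -c.coupling x k =
      -∑ k, 1 / (4 * (1 - c.corrSq k)) * (c.P *ᵥ x) k ^ 2 + (-(c.q x / 4) +
        -∑ k, 1 / (4 * (1 - c.corrSq k)) * (c.H *ᵥ x) k ^ 2) := by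
    have hk : ∑ k, ((c.P *ᵥ x) k - (c.H *ᵥ x) k) ^ 2 / (1 - c.corrSq k) =
        4 * (∑ k, 1 / (4 * (1 - c.corrSq k)) * (c.P *ᵥ x) k ^ 2 +
          ∑ k, 1 / (4 * (1 - c.corrSq k)) * (c.H *ᵥ x) k ^ 2 - ∑ k, c.coupling x k) := by
      rw [← Finset.sum_add_distrib, ← Finset.sum_sub_distrib, Finset.mul_sum]
      refine Finset.sum_congr rfl fun k _ => ?_
      have := sub_pos.2 (hs k)
      unfold coupling
      field_simp
      ring
    rw [c.form_eq hs, hk, Finset.sum_neg_distrib]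
    ring
  simp only [approximant, truncFactor, Finset.prod_mul_distrib, ← Real.exp_sum]
  rw [sqrt_gaussianDensity, ← mul_assoc, mul_assoc (√_) (Real.exp _), ← Real.exp_add, h,
    Real.exp_add, Real.exp_add, ← mul_assoc]

/-- Every monomial in the couplings is a product of a function of the first group and a function of
the second one. -/
lemma sepRank_approximant (hs0 : ∀ k, 0 ≤ c.corrSq k) (hs : ∀ k, c.corrSq k < 1) {n : ℕ}
    (hn : ∏ k, c.order N k ≤ n) : SepRank A n (c.approximant N) := by
  have hpos : ∀ k, 0 < 1 - c.corrSq k := fun k => sub_pos.2 (hs k)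
  obtain ⟨b, hb, hbc⟩ := c.coercive
  refine SepRank.of_fintype (κ := ∀ k : A, Fin (c.order N k))
    (u := fun ν x => √(1 / √((2 * Real.pi) ^ D * S.det)) *
      (Real.exp (-∑ k, 1 / (4 * (1 - c.corrSq k)) * (c.P *ᵥ x) k ^ 2) *
        ∏ k, (c.P *ᵥ x) k ^ (ν k : ℕ)))
    (v := fun ν x => (∏ k, (1 / (2 * (1 - c.corrSq k))) ^ (ν k : ℕ) / (ν k : ℕ).factorial) *
      (Real.exp (-(c.q x / 4)) *
        (Real.exp (-∑ k, 1 / (4 * (1 - c.corrSq k)) * (c.H *ᵥ x) k ^ 2) *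
          ∏ k, (c.H *ᵥ x) k ^ (ν k : ℕ)))) ?_ (fun ν => ?_) (fun ν => ?_) fun x => ?_
  · rwa [Fintype.card_pi, Finset.prod_congr rfl fun k _ => Fintype.card_fin _]
  · -- One half of the Gaussian exponent provides the decay, the other one bounds the monomial.
    refine Tame.const_mul _ ?_
    obtain ⟨K, hK⟩ := exists_abs_exp_mul_prod_pow_le
      (a := fun k => 1 / (8 * (1 - c.corrSq k)))
      (fun k => by have := hpos k; positivity) fun k => (ν k : ℕ)
    have hm := c.measurable_P
    have h := (tame_exp_neg (A := A) (c := b / 8)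
      (Φ := fun x => ∑ k, 1 / (8 * (1 - c.corrSq k)) * (c.P *ᵥ x) k ^ 2) (by fun_prop)
      (fun x y h => by simp only [show c.P *ᵥ x = c.P *ᵥ y from c.dependsOn_P h]) (by positivity)
      fun x => ?_).mul_bounded
      (g := fun x => Real.exp (-∑ k, 1 / (8 * (1 - c.corrSq k)) * (c.P *ᵥ x) k ^ 2) *
        ∏ k, (c.P *ᵥ x) k ^ (ν k : ℕ)) (by fun_prop)
      (fun x y h => by simp only [show c.P *ᵥ x = c.P *ᵥ y from c.dependsOn_P h]) fun x => hK _
    · convert h using 2 with x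
      rw [← mul_assoc, ← Real.exp_add, ← neg_add, ← Finset.sum_add_distrib]
      congr 3
      refine Finset.sum_congr rfl fun k _ => ?_
      have := hpos k
      field_simp
      ring
    · calc b / 8 * ∑ i ∈ A, x i ^ 2 ≤ ∑ k, 1 / 8 * (c.P *ᵥ x) k ^ 2 := by
            rw [← Finset.mul_sum]
            linarith [(hbc x).1]
        _ ≤ _ := Finset.sum_le_sum fun k _ => by
            gcongr
            · have := hpos k; positivity
            · linarith [hs0 k]
  · refine Tame.const_mul _ ?_
    obtain ⟨K, hK⟩ := exists_abs_exp_mul_prod_pow_le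
      (a := fun k => 1 / (4 * (1 - c.corrSq k)))
      (fun k => by have := hpos k; positivity) fun k => (ν k : ℕ)
    have hm := c.measurable_H
    have hq := c.measurable_q
    exact (tame_exp_neg (A := Aᶜ) (c := b / 4) (Φ := fun x => c.q x / 4) (by fun_prop)
      (fun x y h => by simp only [c.dependsOn_q h]) (by positivity)
      fun x => by linarith [(hbc x).2]).mul_bounded (by fun_prop)
      (fun x y h => by simp only [show c.H *ᵥ x = c.H *ᵥ y from c.dependsOn_H h]) fun x => hK _
  · rw [c.approximant_eq N hs]
    simp only [expTaylor]
    rw [Finset.prod_univ_sum, Fintype.piFinset_univ, Finset.mul_sum]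
    refine Finset.sum_congr rfl fun ν _ => ?_
    have h : ∏ k, c.coupling x k ^ (ν k : ℕ) / ((ν k : ℕ).factorial : ℝ) =
        (∏ k, (c.P *ᵥ x) k ^ (ν k : ℕ)) *
          ((∏ k, (1 / (2 * (1 - c.corrSq k))) ^ (ν k : ℕ) / ((ν k : ℕ).factorial : ℝ)) *
            ∏ k, (c.H *ᵥ x) k ^ (ν k : ℕ)) := by
      rw [← Finset.prod_mul_distrib, ← Finset.prod_mul_distrib]
      refine Finset.prod_congr rfl fun k _ => ?_
      rw [coupling, div_eq_mul_one_div ((c.H *ᵥ x) k), mul_pow, mul_pow]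
      ring
    rw [h]
    ring

/-- Under the Gaussian law the relative error is `∏ k, Y k - 1`, where the factors `Y k` depend on
different canonical pairs and hence are independent. -/
lemma eLpNorm_sub_approximant_add_one_le (hS : S.PosDef) (hs : ∀ k, c.corrSq k < 1) {θ : ℝ}
    (h0 : 0 < θ) (h1 : θ < 1) (hsθ : ∀ k, √(c.corrSq k) ≤ θ ^ 2) {l : ℕ}
    (hl : (covBlock S A Aᶜ).rank ≤ l) :
    eLpNorm (fun x => √(gaussianDensity S x) - c.approximant N x) 2 volume + 1 ≤
      (1 + ENNReal.ofReal (θ ^ N / √(1 - θ))) ^ l := by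
  classical
  obtain ⟨M, hM, rfl⟩ := exists_mul_transpose_eq hS
  have hrow : ∀ (L : Matrix A (Fin D) ℝ) z k, (L *ᵥ (M *ᵥ z)) k = (L * M) k ⬝ᵥ z :=
    fun L z k => by rw [mulVec_mulVec]; rfl
  have hcov : ∀ (L L' : Matrix A (Fin D) ℝ) k k',
      (L * M) k ⬝ᵥ (L' * M) k' = (L * (M * Mᵀ) * L'ᵀ) k k' := fun L L' k k' => by
    rw [show L * (M * Mᵀ) * L'ᵀ = (L * M) * (L' * M)ᵀ by
      simp only [transpose_mul, Matrix.mul_assoc]]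
    rfl
  have hHP : c.H * (M * Mᵀ) * c.Pᵀ = diagonal c.corrSq := by
    have := congrArg transpose c.P_H_cov
    simpa only [transpose_mul, transpose_transpose, diagonal_transpose, Matrix.mul_assoc]
      using this
  set Y : A → (Fin D → ℝ) → ℝ := fun k z =>
    truncFactor (c.order N k) (c.coupling (M *ᵥ z) k) with hY
  have hMm : Measurable fun z => M *ᵥ z := by
    refine measurable_pi_lambda _ fun i => ?_
    simp only [mulVec, dotProduct]
    fun_prop
  have hYm : ∀ k, Measurable (Y k) := fun k =>
    (measurable_truncFactor _).comp ((c.measurable_coupling k).comp hMm)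
  have hindep : iIndepFun Y (stdNormal (Fin D)) := by
    have h := iIndepFun_dotProduct_stdNormal
      (fun (k : A) (b : Bool) => (bif b then c.P * M else c.H * M) k) fun k k' hk a b => by
        cases a <;> cases b <;>
          simp [hcov, c.P_cov, c.H_cov, c.P_H_cov, hHP, hk]
    have h' := h.comp (fun k (y : Bool → ℝ) =>
      truncFactor (c.order N k) (y true * (y false / (2 * (1 - c.corrSq k))))) fun k =>
        (measurable_truncFactor _).comp (by fun_prop)
    convert h' using 2 with k
    ext z
    simp [hY, coupling, hrow]
  have hnorm : eLpNorm (fun x => √(gaussianDensity (M * Mᵀ) x) - c.approximant N x) 2 volume =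
      eLpNorm (fun z => ∏ k, Y k z - 1) 2 (stdNormal (Fin D)) := by
    rw [eLpNorm_two_eq, eLpNorm_two_eq]
    congr 1
    have hF : Measurable fun x => ENNReal.ofReal
        ((∏ k, truncFactor (c.order N k) (c.coupling x k) - 1) ^ 2) := by
      have := c.measurable_coupling
      have := fun k => (measurable_truncFactor (c.order N k)).comp (this k)
      exact (((Finset.measurable_prod _ fun k _ => this k).sub_const 1).pow_const 2).ennreal_ofReal
    rw [← lintegral_gaussianDensity_mul M hM hF]
    refine lintegral_congr fun x => ?_
    rw [← ENNReal.ofReal_mul (gaussianDensity_nonneg x), approximant]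
    congr 1
    nth_rewrite 3 [← Real.sq_sqrt (gaussianDensity_nonneg (S := M * Mᵀ) x)]
    ring
  set s : Finset A := Finset.univ.filter fun k => c.corrSq k ≠ 0 with hsdef
  have hY1 : ∀ k, c.corrSq k = 0 → ∀ z, Y k z = 1 := fun k hk z => by
    simp only [hY, coupling, c.H_mulVec_eq_zero hS hk, order, hk, if_true, zero_div, mul_zero,
      truncFactor_one_zero]
  have hprod : ∀ z, ∏ k, Y k z = ∏ k ∈ s, Y k z := fun z =>
    (Finset.prod_subset (Finset.subset_univ s) fun k _ hk => hY1 k (by simpa [s] using hk) z).symm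
  have hδ : ∀ k, eLpNorm (fun z => Y k z - 1) 2 (stdNormal (Fin D)) ≤
      ENNReal.ofReal (θ ^ N / √(1 - θ)) := fun k => by
    rcases eq_or_ne (c.corrSq k) 0 with hk | hk
    · simp [hY1 k hk]
    · have hk0 : 0 < c.corrSq k := (c.corrSq_nonneg hS k).lt_of_ne' hk
      have h := lintegral_sq_truncFactor_sub_one_le (c := (c.P * M) k) (d := (c.H * M) k) hk0
        (hs k) (by rw [hcov, c.P_cov, one_apply_eq])
        (by rw [hcov, c.P_H_cov, diagonal_apply_eq])
        (by rw [hcov, c.H_cov, diagonal_apply_eq]) h0 h1 (hsθ k) N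
      have h1' : 0 < 1 - θ := sub_pos.2 h1
      have hsq : (θ ^ N) ^ 2 * (1 / (1 - θ)) = (θ ^ N / √(1 - θ)) ^ 2 := by
        rw [div_pow, Real.sq_sqrt h1'.le, mul_one_div]
      rw [eLpNorm_two_eq]
      calc _ ≤ (ENNReal.ofReal ((θ ^ N / √(1 - θ)) ^ 2)) ^ (1 / 2 : ℝ) := by
            rw [← hsq]
            refine ENNReal.rpow_le_rpow (le_trans (le_of_eq ?_) h) (by norm_num)
            refine lintegral_congr fun z => ?_
            simp only [hY, coupling, hrow, order, if_neg hk, mul_div_assoc]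
        _ = _ := by
            rw [ENNReal.ofReal_rpow_of_nonneg (by positivity) (by norm_num), ← Real.sqrt_eq_rpow,
              Real.sqrt_sq (by positivity)]
  rw [hnorm]
  simp only [hprod]
  refine (eLpNorm_prod_sub_one_add_one_le hindep hYm hδ s).trans ?_
  refine pow_le_pow_right₀ le_self_add ?_
  rw [hsdef, ← Fintype.card_subtype]
  exact c.card_le_rank.trans hl

end CanonicalCoordinates

end

/-! ### Choice of the truncation order -/

lemma one_add_pow_le {δ : ℝ} (hδ : 0 ≤ δ) {l : ℕ} (h : l * δ ≤ 1) :
    (1 + δ) ^ l ≤ 1 + 2 * (l * δ) := by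
  have h0 : 0 ≤ l * δ := by positivity
  have h1 : (1 + δ) ^ l ≤ Real.exp (l * δ) := by
    rw [Real.exp_nat_mul]
    exact pow_le_pow_left₀ (by positivity) (by linarith [Real.add_one_le_exp δ]) l
  have h2 := (abs_le.1 (Real.abs_exp_sub_one_sub_id_le (abs_le.2 ⟨by linarith, h⟩))).2
  nlinarith

/-- The bipartite approximation: rank `N ^ l` gives an error of order `l * θ ^ N`, where `θ ^ 2`
bounds the canonical correlations. -/
lemma exists_sepRank_approximation {D : ℕ} {S : Matrix (Fin D) (Fin D) ℝ} (hS : S.PosDef)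
    (A : Finset (Fin D)) {θ : ℝ} (h0 : 0 < θ) (h1 : θ < 1) {l N : ℕ} (hN : 1 ≤ N)
    (hl : (covBlock S A Aᶜ).rank ≤ l) (hr : ∀ r, IsCanonicalCorrelation S A r → r ≤ θ ^ 2)
    (hδ : l * (θ ^ N / √(1 - θ)) ≤ 1) :
    ∃ g, SepRank A (N ^ l) g ∧ eLpNorm (fun x => √(gaussianDensity S x) - g x) 2 volume ≤
      ENNReal.ofReal (2 * (l * (θ ^ N / √(1 - θ)))) := by
  obtain ⟨c⟩ := exists_canonicalCoordinates hS A
  have hs0 := c.corrSq_nonneg hS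
  have hsθ : ∀ k, √(c.corrSq k) ≤ θ ^ 2 := fun k => by
    rcases (hs0 k).eq_or_lt with hk | hk
    · rw [← hk, Real.sqrt_zero]
      positivity
    · exact hr _ (c.isCanonicalCorrelation k hk)
  have hs : ∀ k, c.corrSq k < 1 := fun k => by
    have : √(c.corrSq k) < 1 := (hsθ k).trans_lt (pow_lt_one₀ h0.le h1 two_ne_zero)
    rwa [Real.sqrt_lt' one_pos, one_pow] at this
  refine ⟨c.approximant N, c.sepRank_approximant N hs0 hs (c.prod_order_le N hN hl), ?_⟩
  have hpos : 0 ≤ θ ^ N / √(1 - θ) := by positivity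
  have h := c.eLpNorm_sub_approximant_add_one_le N hS hs h0 h1 hsθ hl
  rw [← ENNReal.ofReal_one, ← ENNReal.ofReal_add zero_le_one hpos,
    ← ENNReal.ofReal_pow (by positivity)] at h
  have h2 := h.trans (ENNReal.ofReal_le_ofReal (one_add_pow_le hpos hδ))
  rw [add_comm, ENNReal.ofReal_add zero_le_one (by positivity)] at h2
  exact (ENNReal.add_le_add_iff_left ENNReal.ofReal_ne_top).1 h2

/-- The error `4 * D ^ 2 * l * (θ ^ N / √(1 - θ))` of the network falls below `ε` for `N` of order
`log (l * √D / ε)`: the polynomial prefactor `D ^ 2 * l / ε` is at most `(l * √D / ε) ^ 4`, and the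
logarithm is bounded below because `2 ≤ D`. -/
lemma exists_truncation_order {θ : ℝ} (h0 : 0 < θ) (h1 : θ < 1) :
    ∃ C : ℝ, 0 < C ∧ ∀ D l : ℕ, 2 ≤ D → 1 ≤ l → ∀ ε : ℝ, 0 < ε → ε ≤ 1 →
      ∃ N : ℕ, 1 ≤ N ∧ 4 * D ^ 2 * l * (θ ^ N / √(1 - θ)) ≤ ε ∧
        (N : ℝ) ≤ C * Real.log (l * √D / ε) := by
  have h1' : 0 < 1 - θ := sub_pos.2 h1
  set K := 1 / √(1 - θ) with hK
  have hK1 : 1 ≤ K := by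
    rw [hK, le_div_iff₀ (Real.sqrt_pos.2 h1'), one_mul]
    exact Real.sqrt_le_one.2 (by linarith)
  set L := -Real.log θ with hL
  have hL0 : 0 < L := neg_pos.2 (Real.log_neg h0 h1)
  have hlog4 : 0 < Real.log (4 * K) := Real.log_pos (by linarith)
  have hm : 0 < Real.log (√2) := Real.log_pos (Real.lt_sqrt_of_sq_lt (by norm_num))
  refine ⟨(1 + Real.log (4 * K) / L) / Real.log (√2) + 4 / L, by positivity,
    fun D l hD hl ε hε hε1 => ?_⟩
  have hD' : (2 : ℝ) ≤ D := by exact_mod_cast hD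
  have hl' : (1 : ℝ) ≤ l := by exact_mod_cast hl
  set y := l * √D / ε with hy
  have hy2 : √2 ≤ y := by
    rw [hy, le_div_iff₀ hε]
    calc √2 * ε ≤ √2 * 1 := by gcongr
      _ ≤ l * √D := by
        rw [mul_comm]
        gcongr
  have hy0 : 0 < y := lt_of_lt_of_le (by positivity) hy2
  set R := 4 * D ^ 2 * l * K / ε with hR
  have hR0 : 0 < R := by positivity
  have hR1 : 1 < R := by
    rw [hR, lt_div_iff₀ hε, one_mul]
    have : (1 : ℝ) ≤ D ^ 2 * l * K := by
      have hD2 : (1 : ℝ) ≤ D ^ 2 := by nlinarith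
      exact one_le_mul_of_one_le_of_one_le (one_le_mul_of_one_le_of_one_le hD2 hl') hK1
    linarith
  have hRy : R ≤ 4 * K * y ^ 4 := by
    have hs : √(D : ℝ) ^ 4 = D ^ 2 := by
      rw [show 4 = 2 * 2 from rfl, pow_mul, Real.sq_sqrt (by positivity)]
    have hly : (l : ℝ) / ε ≤ (l / ε) ^ 4 := by
      refine le_self_pow₀ ?_ (by norm_num)
      rw [le_div_iff₀ hε]
      linarith
    calc R = 4 * K * (D ^ 2 * (l / ε)) := by rw [hR]; ring
      _ ≤ 4 * K * (D ^ 2 * (l / ε) ^ 4) := by gcongr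
      _ = 4 * K * y ^ 4 := by rw [hy, ← hs]; ring
  have hlogR : Real.log R ≤ Real.log (4 * K) + 4 * Real.log y := by
    have := Real.log_le_log hR0 hRy
    rwa [Real.log_mul (by positivity) (by positivity), Real.log_pow] at this
  have hlogR0 : 0 < Real.log R := Real.log_pos hR1
  refine ⟨⌈Real.log R / L⌉₊, Nat.ceil_pos.2 (by positivity), ?_, ?_⟩
  · have hN := Nat.le_ceil (Real.log R / L)
    set N := ⌈Real.log R / L⌉₊
    rw [div_le_iff₀ hL0] at hN
    have hθN : θ ^ N ≤ R⁻¹ := by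
      rw [← Real.log_le_log_iff (by positivity) (by positivity), Real.log_pow, Real.log_inv]
      linarith [show (N : ℝ) * Real.log θ = -(N * L) by rw [hL]; ring]
    calc 4 * (D : ℝ) ^ 2 * l * (θ ^ N / √(1 - θ)) = 4 * D ^ 2 * l * K * θ ^ N := by
          rw [hK]; ring
      _ ≤ 4 * D ^ 2 * l * K * R⁻¹ := by gcongr
      _ = ε := by rw [hR]; field_simp
  · have hN := (Nat.ceil_lt_add_one (by positivity : 0 ≤ Real.log R / L)).le
    have hly : Real.log (√2) ≤ Real.log y := Real.log_le_log (by positivity) hy2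
    calc (⌈Real.log R / L⌉₊ : ℝ) ≤ (Real.log (4 * K) + 4 * Real.log y) / L + 1 := by
          refine hN.trans ?_
          gcongr
      _ = (1 + Real.log (4 * K) / L) / Real.log (√2) * Real.log (√2) + 4 / L * Real.log y := by
          field_simp
          ring
      _ ≤ (1 + Real.log (4 * K) / L) / Real.log (√2) * Real.log y + 4 / L * Real.log y := by
          gcongr
      _ = _ := by ring

end GaussianTTN

theorem theorem1 (ρ : ℝ) (hρ : ρ < 1) :
    ∃ C : ℝ, 0 < C ∧
      ∀ (D : ℕ), 2 ≤ D →
      ∀ (V : Type*) [Fintype V] [DecidableEq V] (T : TreeShape D V)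
        (S : Matrix (Fin D) (Fin D) ℝ), S.PosDef →
      ∀ (l : ℕ), 1 ≤ l →
        (∀ u v : V, T.graph.Adj u v →
          (covBlock S (T.side u v) (T.side u v)ᶜ).rank ≤ l) →
        (∀ u v : V, T.graph.Adj u v →
          ∀ r : ℝ, IsCanonicalCorrelation S (T.side u v) r → r ≤ ρ) →
      ∀ ε : ℝ, 0 < ε → ε ≤ 1 →
        ∃ N : FunctionalTTN T,
          eLpNorm (fun x : Fin D → ℝ => √(gaussianDensity S x) - N.eval x) 2 volume
              ≤ ENNReal.ofReal ε ∧
          ∀ e : T.Edge,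
            (N.bondDim e : ℝ) ≤ (C * Real.log (l * √(D : ℝ) / ε)) ^ l := by
  open GaussianTTN in
  -- the lower bound `1 / 2` keeps `θ` positive when `ρ` is not
  set θ := √(max ρ (1 / 2)) with hθ
  have hθ2 : θ ^ 2 = max ρ (1 / 2) :=
    Real.sq_sqrt ((by norm_num : (0 : ℝ) ≤ 1 / 2).trans (le_max_right _ _))
  have h0 : 0 < θ := Real.sqrt_pos.2 (lt_of_lt_of_le (by norm_num) (le_max_right _ _))
  have h1 : θ < 1 := by
    rw [hθ, Real.sqrt_lt' one_pos, one_pow]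
    exact max_lt hρ (by norm_num)
  obtain ⟨C, hC, hCN⟩ := exists_truncation_order h0 h1
  refine ⟨C, hC, fun D hD V _ _ T S hS l hl hrank hcorr ε hε hε1 => ?_⟩
  obtain ⟨N, hN, hNε, hNC⟩ := hCN D l hD hl ε hε hε1
  set δ := θ ^ N / √(1 - θ) with hδ
  have hδ0 : 0 ≤ δ := by positivity
  have hD' : (2 : ℝ) ≤ D := by exact_mod_cast hD
  have hlδ : l * δ ≤ 1 := by
    have h : l * δ ≤ 4 * D ^ 2 * (l * δ) :=
      le_mul_of_one_le_left (by positivity) (by nlinarith)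
    linarith
  obtain ⟨W, hW, hWε⟩ := exists_functionalTTN_of_bipartite T (Nat.one_le_pow l N hN)
    (tame_sqrt_gaussianDensity hS) (δ := ENNReal.ofReal (2 * (l * δ))) fun u v huv =>
      exists_sepRank_approximation hS _ h0 h1 hN (hrank u v huv)
        (fun r hr => (hcorr u v huv r hr).trans (hθ2 ▸ le_max_left _ _)) hlδ
  refine ⟨W, hWε.trans ?_, fun e => ?_⟩
  · rw [← ENNReal.ofReal_natCast, ← ENNReal.ofReal_ofNat 2, ← ENNReal.ofReal_mul (by norm_num),
      ← ENNReal.ofReal_mul (by positivity)]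
    refine ENNReal.ofReal_le_ofReal (le_trans (le_of_eq ?_) hNε)
    push_cast
    ring
  · rw [hW, Nat.cast_pow]
    exact pow_le_pow_left₀ (by positivity) hNC l
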